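/- A structure $(M,S_1,S_2,\dots,\#)$ consists of a set $M$, non-empty collections $S_n\subseteq P(M^n)$ for $n\ge 1$, and a function $\#:S_1\to M$. Formulas are those of the corresponding many-sorted language: object variables range over $M$, $n$-ary relation variables over $S_n$ (set variables over $S_1$), and object terms are object variables and $\#X$ with $X$ a set variable. A formula is arithmetical if it has no bound relation variables; it is $\Sigma^1_1$ (resp. $\Pi^1_1$) if it consists of finitely many existential (resp. universal) relation quantifiers, of any arities, in front of an arithmetical formula. The theory $\Delta^1_1\text{-}\mathrm{HP}_0$ consists of Hume's Principle, "$\#X=\#Y$ if and only if there is (in $S_2$) the graph of a bijection $f:X\to Y$", together with all instances, with object and relation parameters, of $$[\forall \bar n\,(\varphi(\bar n)\leftrightarrow\psi(\bar n))]\rightarrow \exists R\,\forall\bar n\,(\bar n\in R\leftrightarrow\varphi(\bar n)),$$ where $\varphi$ is $\Sigma^1_1$, $\psi$ is $\Pi^1_1$, and $R$ is not free in $\varphi,\psi$. Write $P(n,m)$ if there are $X,Y\in S_1$ with $\#X=n$, $\#Y=m$ and $X=Y\setminus\{y\}$ for some $y\in Y$. A set $F\in S_1$ is hereditary if $n\in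 F$ and $P(n,m)$ imply $m\in F$, and closed if $P(\#\emptyset,m)$ implies $m\in F$. An object $n$ is a pseudo-number if $n=\#\emptyset$ or $n$ belongs to every hereditary, closed $F\in S_1$. The successor axiom $\mathrm{SA}$ says that for every pseudo-number $n$ there is $m$ with $P(n,m)$. Let $k$ be an algebraically closed field of characteristic zero that is saturated as a structure in the language of rings: for every $A\subseteq k$ with $|A|<|k|$, every finitely realized set of formulas over $A$ in finitely many free variables is realized in $k$. Let $D(k^n)$ be the collection of subsets of $k^n$ definable with parameters in $k$. Then every $X\in D(k)$ is finite or cofinite. Define $\#:D(k)\to k$ by $\#X=|X|$ if $X$ is finite and $\#X=-(|k\setminus X|+1)$ if $X$ is cofinite. Then this is well defined, and $$(k,D(k),D(k^2),\dots,\#)\models \Delta^1_1\text{-}\mathrm{HP}_0+\neg\mathrm{SA}.$$ Moreover, the pseudo-numbers of this structure are exactly the integers, and $\#k=-1$ has no successor: there is no $m\in k$ with $P(\#k,m)$. In particular, there is a model of $\Delta^1_1\text{-}\mathrm{HP}_0+\neg\mathrm{SA}$, which answers a question of Linnebo. -/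

import Mathlib

universe u v w

/-- A first-order structure `M` is saturated if, for every `A ⊆ M` with `|A| < |M|`, every set of
formulas with parameters from `A` in finitely many free variables that is finitely realized
in `M` is realized in `M`. -/
def FirstOrder.Language.IsSaturated (L : FirstOrder.Language.{v, w}) (M : Type u)
    [L.Structure M] : Prop :=
  ∀ A : Set M, Cardinal.mk A < Cardinal.mk M →
    ∀ (n : ℕ) (p : Set ((L.withConstants A).Formula (Fin n))),
      (∀ q : Set ((L.withConstants A).Formula (Fin n)), q ⊆ p → q.Finite →
        ∃ b : Fin n → M, ∀ θ ∈ q, θ.Realize b) →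
      ∃ b : Fin n → M, ∀ θ ∈ p, θ.Realize b

/-- A structure `(M, S₁, S₂, …, #)` in the signature of Hume's Principle: `rel n` is the collection
`S_{n+1}` of `(n+1)`-ary relations on `M` over which the relation quantifiers range, and
`num : S₁ → M` is the interpretation of `#`. As usual in many-sorted logic, the sorts are non-empty
(for `M` this follows from the existence of `num`). -/
structure HPStructure (M : Type u) where
  rel : (n : ℕ) → Set (Set (Fin (n + 1) → M))
  rel_nonempty : ∀ n, (rel n).Nonempty
  num : rel 0 → M

/-- Object terms of the signature: object variables `x_i` and `# X_i`, for `X_i` a set variable. -/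
inductive HPTerm : Type
  | var (i : ℕ) : HPTerm
  | num (i : ℕ) : HPTerm

/-- Formulas of the many-sorted signature of Hume's Principle. The `(n+1)`-ary relation variables
are indexed by pairs `(n, i)`; set variables are the pairs `(0, i)`. The remaining connectives and
the existential object quantifier are the usual classical abbreviations. -/
inductive HPFormula : Type
  /-- equality of objects -/
  | eq (t s : HPTerm) : HPFormula
  /-- equality of two `(n+1)`-ary relations -/
  | relEq (n i j : ℕ) : HPFormula
  /-- the relation variable `(n, i)` holds of the `(n+1)`-tuple `t` -/
  | mem (n i : ℕ) (t : Fin (n + 1) → HPTerm) : HPFormula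
  | neg (φ : HPFormula) : HPFormula
  | and (φ ψ : HPFormula) : HPFormula
  | allObj (i : ℕ) (φ : HPFormula) : HPFormula
  | allRel (n i : ℕ) (φ : HPFormula) : HPFormula
  | exRel (n i : ℕ) (φ : HPFormula) : HPFormula

namespace HPFormula

/-- A formula is arithmetical if it contains no bound relation variables of any arity. -/
def IsArithmetical : HPFormula → Prop
  | eq _ _ => True
  | relEq _ _ _ => True
  | mem _ _ _ => True
  | neg φ => φ.IsArithmetical
  | and φ ψ => φ.IsArithmetical ∧ ψ.IsArithmetical
  | allObj _ φ => φ.IsArithmetical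
  | allRel _ _ _ => False
  | exRel _ _ _ => False

/-- `Σ¹₁`: finitely many existential relation quantifiers in front of an arithmetical formula. -/
inductive IsSigma11 : HPFormula → Prop
  | arith {φ : HPFormula} (h : φ.IsArithmetical) : IsSigma11 φ
  | ex (n i : ℕ) {φ : HPFormula} (h : IsSigma11 φ) : IsSigma11 (exRel n i φ)

/-- `Π¹₁`: finitely many universal relation quantifiers in front of an arithmetical formula. -/
inductive IsPi11 : HPFormula → Prop
  | arith {φ : HPFormula} (h : φ.IsArithmetical) : IsPi11 φ
  | all (n i : ℕ) {φ : HPFormula} (h : IsPi11 φ) : IsPi11 (allRel n i φ)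

end HPFormula

namespace HPStructure

variable {M : Type u}

/-- An assignment of relations of the structure to all relation variables. -/
abbrev RelAssignment (N : HPStructure M) : Type u := (n : ℕ) → ℕ → N.rel n

/-- Reassign the `(n+1)`-ary relation variable `(n, i)` to `R`. -/
def RelAssignment.set {N : HPStructure M} (ρ : N.RelAssignment) (n i : ℕ) (R : N.rel n) :
    N.RelAssignment :=
  Function.update ρ n (Function.update (ρ n) i R)

/-- The value of an object term. -/
def termValue (N : HPStructure M) (v : ℕ → M) (ρ : N.RelAssignment) : HPTerm → M
  | .var i => v i
  | .num i => N.num (ρ 0 i)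

/-- Satisfaction of a formula in the structure under an assignment: object quantifiers range over
`M`, and quantifiers over `(n+1)`-ary relations range over `N.rel n`. -/
def Sat (N : HPStructure M) : HPFormula → (ℕ → M) → N.RelAssignment → Prop
  | .eq t s, v, ρ => N.termValue v ρ t = N.termValue v ρ s
  | .relEq n i j, _, ρ => ρ n i = ρ n j
  | .mem n i t, v, ρ => (fun j => N.termValue v ρ (t j)) ∈ (ρ n i : Set (Fin (n + 1) → M))
  | .neg φ, v, ρ => ¬ N.Sat φ v ρ
  | .and φ ψ, v, ρ => N.Sat φ v ρ ∧ N.Sat ψ v ρ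
  | .allObj i φ, v, ρ => ∀ a : M, N.Sat φ (Function.update v i a) ρ
  | .allRel n i φ, v, ρ => ∀ R : N.rel n, N.Sat φ v (ρ.set n i R)
  | .exRel n i φ, v, ρ => ∃ R : N.rel n, N.Sat φ v (ρ.set n i R)

/-- The `Δ¹₁`-comprehension schema: for `φ` a `Σ¹₁`-formula, `ψ` a `Π¹₁`-formula, and a tuple `z` of
distinct object variables, if `φ` and `ψ` agree at all values of `z` (the other free
variables being object or relation parameters, given by `v` and `ρ`), then the relation defined
by `φ` in the variables `z` belongs to the structure. -/
def Delta11Comprehension (N : HPStructure M) : Prop :=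
  ∀ φ ψ : HPFormula, φ.IsSigma11 → ψ.IsPi11 →
    ∀ (n : ℕ) (z : Fin (n + 1) → ℕ), Function.Injective z →
    ∀ (v : ℕ → M) (ρ : N.RelAssignment),
      (∀ a : Fin (n + 1) → M,
        N.Sat φ (Function.extend z a v) ρ ↔ N.Sat ψ (Function.extend z a v) ρ) →
      ∃ R : N.rel n, ∀ a : Fin (n + 1) → M,
        a ∈ (R : Set (Fin (n + 1) → M)) ↔ N.Sat φ (Function.extend z a v) ρ

/-- Membership of an object in a set of the structure. -/
def Mem (N : HPStructure M) (x : M) (X : N.rel 0) : Prop := ![x] ∈ (X : Set (Fin 1 → M))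

/-- The binary relation `f` of the structure is (the graph of) a bijection from `X` to `Y`. -/
def IsBijection (N : HPStructure M) (f : N.rel 1) (X Y : N.rel 0) : Prop :=
  (∀ x y, ![x, y] ∈ (f : Set (Fin 2 → M)) → N.Mem x X ∧ N.Mem y Y) ∧
  (∀ x, N.Mem x X → ∃! y, ![x, y] ∈ (f : Set (Fin 2 → M))) ∧
  (∀ y, N.Mem y Y → ∃! x, ![x, y] ∈ (f : Set (Fin 2 → M)))

/-- Hume's Principle: `#X = #Y` iff there is a bijection `f : X → Y` in the structure. -/
def HumesPrinciple (N : HPStructure M) : Prop :=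
  ∀ X Y : N.rel 0, N.num X = N.num Y ↔ ∃ f : N.rel 1, N.IsBijection f X Y

/-- The structure is a model of `Δ¹₁-HP₀`. -/
def ModelsDelta11HP (N : HPStructure M) : Prop :=
  N.HumesPrinciple ∧ N.Delta11Comprehension

/-- `P(n, m)`: there are sets `X`, `Y` with `#X = n`, `#Y = m` and `X = Y \ {y}`
for some `y ∈ Y`. -/
def Precedes (N : HPStructure M) (n m : M) : Prop :=
  ∃ X Y : N.rel 0, N.num X = n ∧ N.num Y = m ∧
    ∃ y, N.Mem y Y ∧ ∀ x, N.Mem x X ↔ N.Mem x Y ∧ x ≠ y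

/-- `n = #∅`. -/
def IsZero (N : HPStructure M) (n : M) : Prop :=
  ∃ E : N.rel 0, (∀ x, ¬ N.Mem x E) ∧ n = N.num E

/-- `F` is hereditary if `Fn` and `P(n, m)` imply `Fm`. -/
def Hereditary (N : HPStructure M) (F : N.rel 0) : Prop :=
  ∀ n m, N.Mem n F → N.Precedes n m → N.Mem m F

/-- `F` is closed if `P(#∅, m)` implies `Fm`. -/
def IsClosedSet (N : HPStructure M) (F : N.rel 0) : Prop :=
  ∀ z m, N.IsZero z → N.Precedes z m → N.Mem m F

/-- `n` is a pseudo-number if `n = #∅` or `n` lies in every hereditary, closed set `F`. -/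
def IsPseudoNumber (N : HPStructure M) (n : M) : Prop :=
  N.IsZero n ∨ ∀ F : N.rel 0, N.Hereditary F → N.IsClosedSet F → N.Mem n F

/-- The successor axiom `SA`: for every pseudo-number `n` there is `m` with `P(n, m)`. -/
def SuccessorAxiom (N : HPStructure M) : Prop :=
  ∀ n, N.IsPseudoNumber n → ∃ m, N.Precedes n m

open Classical in
/-- The structure `(k, D(k), D(k²), …, #)`, where `D(kⁿ)` is the collection of subsets of `kⁿ`
definable with parameters in the field `k`, `#X = |X|` for `X` finite and `#X = -(|k \ X| + 1)`
for `X` cofinite. -/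
noncomputable def ofField (k : Type u) [Field k] [FirstOrder.Ring.CompatibleRing k] :
    HPStructure k where
  rel n := {X : Set (Fin (n + 1) → k) | (Set.univ : Set k).Definable FirstOrder.Language.ring X}
  rel_nonempty _ := ⟨∅, Set.definable_empty⟩
  num X :=
    if (X : Set (Fin 1 → k)).Finite then ((X : Set (Fin 1 → k)).ncard : k)
    else -(((X : Set (Fin 1 → k))ᶜ.ncard : k) + 1)

end HPStructure

open FirstOrder FirstOrder.Language

section Compactness

variable {L : FirstOrder.Language.{v, w}} {M : Type u} [L.Structure M]

/-- Every cover of a finite power of `M` by sets definable over a fixed finite set of parameters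
has a finite subcover. -/
def FirstOrder.Language.IsDefinablyCompact (L : FirstOrder.Language.{v, w}) (M : Type u)
    [L.Structure M] : Prop :=
  ∀ A : Set M, A.Finite → ∀ (n : ℕ) (C : Set (Set (Fin n → M))),
    (∀ s ∈ C, A.Definable L s) → ⋃₀ C = Set.univ → ∃ C' ⊆ C, C'.Finite ∧ ⋃₀ C' = Set.univ

theorem FirstOrder.Language.IsSaturated.isDefinablyCompact [Infinite M] (h : L.IsSaturated M) :
    L.IsDefinablyCompact M := by
  intro A hA n C hC hcov
  let p : Set (L[[A]].Formula (Fin n)) := {θ | {x | θ.Realize x}ᶜ ∈ C}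
  by_contra hno
  push Not at hno
  obtain ⟨b, hb⟩ := h A (hA.lt_aleph0.trans_le (Cardinal.aleph0_le_mk M)) n p (by
    intro q hq hqf
    by_contra hb
    push Not at hb
    refine hno ((fun θ : L[[A]].Formula (Fin n) => {x | θ.Realize x}ᶜ) '' q) ?_ (hqf.image _) ?_
    · rintro _ ⟨θ, hθ, rfl⟩
      exact hq hθ
    · refine Set.eq_univ_of_forall fun x => ?_
      obtain ⟨θ, hθ, hx⟩ := hb x
      exact ⟨_, ⟨θ, hθ, rfl⟩, hx⟩)
  have hb' : b ∈ ⋃₀ C := hcov ▸ Set.mem_univ b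
  obtain ⟨s, hs, hbs⟩ := hb'
  obtain ⟨θ, hθ⟩ := (hC s hs).compl
  have h1 : {x | θ.Realize x}ᶜ = s := by
    rw [← compl_compl s, hθ]
  have := hb θ (show _ ∈ C from h1 ▸ hs)
  rw [← h1] at hbs
  exact hbs this

theorem FirstOrder.Language.IsDefinablyCompact.exists_finite_subcover
    (h : L.IsDefinablyCompact M) {A : Set M} (hA : A.Finite) {β : Type*} [Finite β]
    (C : Set (Set (β → M))) (hC : ∀ s ∈ C, A.Definable L s) (hcov : ⋃₀ C = Set.univ) :
    ∃ C' ⊆ C, C'.Finite ∧ ⋃₀ C' = Set.univ := by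
  obtain ⟨n, ⟨e⟩⟩ := Finite.exists_equiv_fin β
  obtain ⟨D, hD, hDf, hDu⟩ := h A hA n ((fun s => (fun g : Fin n → M => g ∘ e) ⁻¹' s) '' C)
    (by
      rintro _ ⟨s, hs, rfl⟩
      exact (hC s hs).preimage_comp e)
    (by
      refine Set.eq_univ_of_forall fun x => ?_
      have hx : x ∘ e ∈ ⋃₀ C := hcov ▸ Set.mem_univ _
      obtain ⟨s, hs, hxs⟩ := hx
      exact ⟨_, ⟨s, hs, rfl⟩, hxs⟩)
  obtain ⟨C', hC', hf, rfl⟩ := Set.exists_subset_image_finite_and.1 ⟨D, hD, hDf, rfl⟩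
  refine ⟨C', hC', hf, Set.eq_univ_of_forall fun x => ?_⟩
  have hx : x ∘ e.symm ∈ ⋃₀ ((fun s => (fun g : Fin n → M => g ∘ e) ⁻¹' s) '' C') :=
    hDu ▸ Set.mem_univ _
  obtain ⟨_, ⟨s, hs, rfl⟩, hxs⟩ := hx
  refine ⟨s, hs, ?_⟩
  simpa [Function.comp_assoc] using hxs

/-- `O` is a union of `A`-definable sets. -/
def Set.LocallyDefinable (A : Set M) (L : FirstOrder.Language.{v, w}) [L.Structure M]
    {β : Type*} (O : Set (β → M)) : Prop :=
  ∀ x ∈ O, ∃ s, A.Definable L s ∧ x ∈ s ∧ s ⊆ O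

theorem Set.Definable.locallyDefinable {A : Set M} {β : Type*} {s : Set (β → M)}
    (h : A.Definable L s) : A.LocallyDefinable L s :=
  fun _ hx => ⟨s, h, hx, subset_rfl⟩

theorem Set.definable_sUnion_of_finite {A : Set M} {β : Type*} {C : Set (Set (β → M))}
    (hf : C.Finite) (h : ∀ s ∈ C, A.Definable L s) : A.Definable L (⋃₀ C) := by
  rw [Set.sUnion_eq_iUnion]
  have := hf.to_subtype
  exact Set.definable_iUnion_of_finite fun s => h s s.2

theorem Set.LocallyDefinable.definable (h : L.IsDefinablyCompact M) {A : Set M} (hA : A.Finite)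
    {β : Type*} [Finite β] {O : Set (β → M)} (h1 : A.LocallyDefinable L O)
    (h2 : A.LocallyDefinable L Oᶜ) : A.Definable L O := by
  obtain ⟨C, hC, hf, hu⟩ := h.exists_finite_subcover hA
    {s | A.Definable L s ∧ (s ⊆ O ∨ s ⊆ Oᶜ)} (fun s hs => hs.1) (by
      refine Set.eq_univ_of_forall fun x => ?_
      by_cases hx : x ∈ O
      · obtain ⟨s, hs, hxs, hsO⟩ := h1 x hx
        exact ⟨s, ⟨hs, .inl hsO⟩, hxs⟩
      · obtain ⟨s, hs, hxs, hsO⟩ := h2 x hx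
        exact ⟨s, ⟨hs, .inr hsO⟩, hxs⟩)
  have : O = ⋃₀ {s ∈ C | s ⊆ O} := by
    ext x
    constructor
    · intro hx
      have hx' : x ∈ ⋃₀ C := hu ▸ Set.mem_univ x
      obtain ⟨s, hs, hxs⟩ := hx'
      refine ⟨s, ⟨hs, (hC hs).2.resolve_right fun hn => hn hxs hx⟩, hxs⟩
    · rintro ⟨s, hs, hxs⟩
      exact hs.2 hxs
  rw [this]
  exact Set.definable_sUnion_of_finite (hf.subset (Set.sep_subset _ _)) fun s hs => (hC hs.1).1

/-- An automorphism fixing the parameters preserves definable sets. -/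
theorem Set.Definable.mem_iff_comp_mem {A : Set M} {β : Type*} {s : Set (β → M)}
    (h : A.Definable L s) (σ : L.Equiv M M) (hσ : ∀ a ∈ A, σ a = a) (x : β → M) :
    x ∈ s ↔ σ ∘ x ∈ s := by
  obtain ⟨φ, rfl⟩ := Set.definable_iff_exists_formula_sum.1 h
  have := StrongHomClass.realize_formula σ φ (v := Sum.elim (↑) x)
  rw [Set.mem_ofPred_eq, Set.mem_ofPred_eq, ← this]
  have h2 : σ ∘ Sum.elim (fun a : A => (a : M)) x = Sum.elim (fun a : A => (a : M)) (σ ∘ x) := by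
    funext a
    rcases a with a | b
    · exact hσ a a.2
    · rfl
  rw [h2]

theorem Set.Finite.definable_of_forall_mem {A : Set M} {β : Type*} [Finite β] {s : Set (β → M)}
    (hf : s.Finite) (hs : ∀ x ∈ s, ∀ i, x i ∈ A) : A.Definable L s := by
  have : s = ⋃₀ ((fun x => {x}) '' s) := by ext; simp
  rw [this]
  refine Set.definable_sUnion_of_finite (hf.image _) ?_
  rintro _ ⟨x, hx, rfl⟩
  have : ({x} : Set (β → M)) = ⋂ i, {y | y i = x i} := by ext; simp [funext_iff]
  change A.Definable L {x}
  rw [this]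
  exact Set.definable_iInter_of_finite fun i =>
    Set.DefinableFun.ofPred_eq_const (Set.DefinableFun.proj L) (hs x hx i)

theorem Set.Finite.definable_univ {β : Type*} [Finite β] {s : Set (β → M)} (hs : s.Finite) :
    (Set.univ : Set M).Definable L s :=
  hs.definable_of_forall_mem fun _ _ _ => Set.mem_univ _

end Compactness

theorem AlgebraicIndependent.exists_ringEquiv_swap {k : Type u} [Field k] {R : Type*}
    [CommRing R] [Algebra R k] [IsAlgClosed k] {t s : k} (h : AlgebraicIndepOn R id {t, s}) :
    ∃ σ : k ≃+* k, (∀ r : R, σ (algebraMap R k r) = algebraMap R k r) ∧ σ t = s := by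
  classical
  obtain ⟨B, hB, hb⟩ := exists_isTranscendenceBasis_superset h
  let t' : B := ⟨t, hB (by simp)⟩
  let s' : B := ⟨s, hB (by simp)⟩
  let f : Algebra.adjoin R (Set.range ((↑) : B → k)) ≃ₐ[R]
      Algebra.adjoin R (Set.range ((↑) : B → k)) :=
    (hb.1.aevalEquiv.symm.trans (MvPolynomial.renameEquiv R (Equiv.swap t' s'))).trans
      hb.1.aevalEquiv
  have := IsAlgClosed.isAlgClosure_of_transcendence_basis _ hb
  let σ : k ≃+* k := IsAlgClosure.equivOfEquiv k k f.toRingEquiv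
  have hσ : ∀ x, σ (algebraMap _ k x) = algebraMap _ k (f x) :=
    fun x => IsAlgClosure.equivOfEquiv_algebraMap k k f.toRingEquiv x
  refine ⟨σ, fun r => ?_, ?_⟩
  · have := hσ (algebraMap R _ r)
    rw [f.commutes] at this
    exact this
  · have h1 : hb.1.aevalEquiv (MvPolynomial.X t') = ⟨t, Algebra.subset_adjoin ⟨t', rfl⟩⟩ := by
      ext; simp [t']
    have h2 := hσ ⟨t, Algebra.subset_adjoin ⟨t', rfl⟩⟩
    rw [← h1] at h2
    simpa [f, t', s'] using h2

section StronglyMinimal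

variable {k : Type u} [Field k] [FirstOrder.Ring.CompatibleRing k]

theorem Set.DefinableFun.add {A : Set k} {β : Type*} {f g : (β → k) → k}
    (hf : A.DefinableFun Language.ring f) (hg : A.DefinableFun Language.ring g) :
    A.DefinableFun Language.ring (fun x => f x + g x) := by
  have h := (Set.DefinableFun.fun_symbol (M := k) FirstOrder.Ring.addFunc).mono
    (Set.empty_subset A)
  have hm : A.DefinableMap Language.ring (fun x => ![f x, g x]) := by
    simp [Set.DefinableMap, *]
  simpa using Set.DefinableFun.comp hm h

theorem Set.DefinableFun.mul {A : Set k} {β : Type*} {f g : (β → k) → k}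
    (hf : A.DefinableFun Language.ring f) (hg : A.DefinableFun Language.ring g) :
    A.DefinableFun Language.ring (fun x => f x * g x) := by
  have h := (Set.DefinableFun.fun_symbol (M := k) FirstOrder.Ring.mulFunc).mono
    (Set.empty_subset A)
  have hm : A.DefinableMap Language.ring (fun x => ![f x, g x]) := by
    simp [Set.DefinableMap, *]
  simpa using Set.DefinableFun.comp hm h

theorem Set.DefinableFun.neg {A : Set k} {β : Type*} {f : (β → k) → k}
    (hf : A.DefinableFun Language.ring f) :
    A.DefinableFun Language.ring (fun x => -f x) := by
  have h := (Set.DefinableFun.fun_symbol (M := k) FirstOrder.Ring.negFunc).mono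
    (Set.empty_subset A)
  have hm : A.DefinableMap Language.ring (fun x => ![f x]) := by
    simp [Set.DefinableMap, *]
  simpa using Set.DefinableFun.comp hm h

theorem Set.DefinableFun.zero {A : Set k} {β : Type*} :
    A.DefinableFun Language.ring (fun _ : β → k => 0) := by
  have h := ((0 : Language.ring.Term β).definableFun_realize (M := k)).mono (Set.empty_subset A)
  simpa [funext_iff] using! h

theorem Set.DefinableFun.one {A : Set k} {β : Type*} :
    A.DefinableFun Language.ring (fun _ : β → k => 1) := by
  have h := ((1 : Language.ring.Term β).definableFun_realize (M := k)).mono (Set.empty_subset A)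
  simpa [funext_iff] using! h

theorem Set.DefinableFun.pow {A : Set k} {β : Type*} {f : (β → k) → k}
    (hf : A.DefinableFun Language.ring f) (n : ℕ) :
    A.DefinableFun Language.ring (fun x => f x ^ n) := by
  induction n with
  | zero => simpa using Set.DefinableFun.one
  | succ n ih => simpa [pow_succ] using ih.mul hf

theorem Set.DefinableFun.natCast {A : Set k} {β : Type*} (n : ℕ) :
    A.DefinableFun Language.ring (fun _ : β → k => (n : k)) := by
  induction n with
  | zero => simpa using Set.DefinableFun.zero
  | succ n ih => simpa using ih.add Set.DefinableFun.one

theorem Set.DefinableFun.intCast {A : Set k} {β : Type*} (n : ℤ) :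
    A.DefinableFun Language.ring (fun _ : β → k => (n : k)) := by
  obtain ⟨n, rfl | rfl⟩ := n.eq_nat_or_neg
  · simpa using Set.DefinableFun.natCast n
  · simpa using (Set.DefinableFun.natCast n).neg

/-- A point lying in no finite `A`-definable set. -/
def FirstOrder.Ring.IsGeneric (A : Set k) (t : k) : Prop :=
  ∀ Y : Set (Fin 1 → k), A.Definable Language.ring Y → Y.Finite → ![t] ∉ Y

open FirstOrder.Ring

theorem FirstOrder.Language.IsDefinablyCompact.exists_isGeneric
    (h : Language.ring.IsDefinablyCompact k) {A : Set k} (hA : A.Finite) {X : Set (Fin 1 → k)}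
    (hX : A.Definable Language.ring X) (hi : X.Infinite) : ∃ t, ![t] ∈ X ∧ IsGeneric A t := by
  by_contra hno
  simp only [IsGeneric] at hno
  push Not at hno
  obtain ⟨C, hC, hf, hu⟩ := h.exists_finite_subcover hA
    {s | A.Definable Language.ring s ∧ (s = Xᶜ ∨ s.Finite)} (fun s hs => hs.1) (by
      refine Set.eq_univ_of_forall fun x => ?_
      have hx1 : ![x 0] = x := by ext i; fin_cases i; rfl
      by_cases hx : x ∈ X
      · obtain ⟨Y, hY, hYf, hxY⟩ := hno (x 0) (hx1 ▸ hx)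
        exact ⟨Y, ⟨hY, .inr hYf⟩, hx1 ▸ hxY⟩
      · exact ⟨Xᶜ, ⟨hX.compl, .inl rfl⟩, hx⟩)
  refine hi ((Set.Finite.sUnion (s := {s ∈ C | s.Finite}) (hf.subset (Set.sep_subset _ _))
    fun s hs => hs.2).subset fun x hx => ?_)
  have hx' : x ∈ ⋃₀ C := hu ▸ Set.mem_univ x
  obtain ⟨s, hs, hxs⟩ := hx'
  refine ⟨s, ⟨hs, (hC hs).2.resolve_left fun he => ?_⟩, hxs⟩
  rw [he] at hxs
  exact hxs hx

theorem FirstOrder.Ring.IsGeneric.transcendental {A : Set k} {t : k} (ht : IsGeneric A t)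
    {S : Type*} [CommRing S] [Algebra S k] [FaithfulSMul S k]
    (hS : ∀ c : S, A.DefinableFun Language.ring (fun _ : Fin 1 → k => algebraMap S k c)) :
    Transcendental S t := by
  classical
  rintro ⟨p, hp, hpt⟩
  have hd : A.DefinableFun Language.ring (fun x : Fin 1 → k => Polynomial.aeval (x 0) p) := by
    clear hp hpt
    induction p using Polynomial.induction_on' with
    | add p q hp hq => simpa using hp.add hq
    | monomial n a =>
      simpa [Polynomial.aeval_monomial] using
        (hS a).mul ((Set.DefinableFun.proj Language.ring).pow n)
  refine ht _ (hd.ofPred_eq Set.DefinableFun.zero) ?_ hpt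
  have hp' : p.map (algebraMap S k) ≠ 0 :=
    (Polynomial.map_ne_zero_iff (FaithfulSMul.algebraMap_injective S k)).2 hp
  refine ((p.map (algebraMap S k)).roots.toFinset.finite_toSet.preimage
    (f := fun x : Fin 1 → k => x 0) ?_).subset ?_
  · intro x _ y _ hxy
    ext i; fin_cases i; exact hxy
  · intro x hx
    simpa [hp', Polynomial.aeval_def, Polynomial.eval_map] using hx

theorem Set.DefinableFun.const_of_mem_adjoin {A : Set k} {β : Type*} {R : Type*} [CommRing R]
    [Algebra R k]
    (hR : ∀ c : R, A.DefinableFun Language.ring (fun _ : β → k => algebraMap R k c))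
    {B : Set k} (hB : ∀ b ∈ B, A.DefinableFun Language.ring (fun _ : β → k => b)) {c : k}
    (hc : c ∈ Algebra.adjoin R B) : A.DefinableFun Language.ring (fun _ : β → k => c) := by
  induction hc using Algebra.adjoin_induction with
  | mem x hx => exact hB x hx
  | algebraMap r => exact hR r
  | add x y _ _ hx hy => exact hx.add hy
  | mul x y _ _ hx hy => exact hx.mul hy

theorem FirstOrder.Ring.IsGeneric.exists_ringEquiv [IsAlgClosed k] {A : Set k} {t s : k}
    (ht : IsGeneric A t) (hs : IsGeneric (insert t A) s) :
    ∃ σ : k ≃+* k, (∀ a ∈ A, σ a = a) ∧ σ t = s := by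
  let R := Algebra.adjoin ℤ A
  have hR : ∀ {β : Type} (c : R), A.DefinableFun Language.ring
      (fun _ : β → k => algebraMap R k c) := fun {β} c =>
    Set.DefinableFun.const_of_mem_adjoin (R := ℤ) (B := A)
      (fun c => by simpa using Set.DefinableFun.intCast c)
      (fun b hb => Language.ring.definableFun_const β hb) c.2
  have htt : Transcendental R t := ht.transcendental hR
  have hst : Transcendental (Algebra.adjoin R {t}) s := hs.transcendental fun c =>
    Set.DefinableFun.const_of_mem_adjoin (R := R) (B := {t})
      (fun c => (hR c).mono (Set.subset_insert _ _))
      (fun b hb => Language.ring.definableFun_const _ (by simp_all)) c.2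
  have hts : s ∉ ({t} : Set k) := by
    rintro rfl
    exact hst (isAlgebraic_algebraMap (⟨s, Algebra.subset_adjoin rfl⟩ : Algebra.adjoin R {s}))
  have hind : AlgebraicIndepOn R id ({s, t} : Set k) := by
    rw [AlgebraicIndepOn.insert_iff hts]
    exact ⟨by simpa using htt, by rw [Set.image_id]; exact hst⟩
  obtain ⟨σ, h1, h2⟩ := AlgebraicIndependent.exists_ringEquiv_swap (R := R) (t := t) (s := s)
    (by rwa [Set.pair_comm])
  exact ⟨σ, fun a ha => h1 ⟨a, Algebra.subset_adjoin ha⟩, h2⟩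

/-- Definable subsets of a definably compact algebraically closed field are finite or cofinite. -/
theorem Set.Definable.finite_or_finite_compl [IsAlgClosed k]
    (h : Language.ring.IsDefinablyCompact k) {A : Set k} {X : Set (Fin 1 → k)}
    (hX : A.Definable Language.ring X) : X.Finite ∨ Xᶜ.Finite := by
  obtain ⟨A, -, hX⟩ := Set.definable_iff_finitely_definable.1 hX
  by_contra hno
  push Not at hno
  obtain ⟨t, htX, ht⟩ := h.exists_isGeneric A.finite_toSet hX hno.1
  obtain ⟨s, hsX, hs⟩ := h.exists_isGeneric (A.finite_toSet.insert t)
    (hX.compl.mono (Set.subset_insert _ _)) hno.2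
  obtain ⟨σ, hσ, hσt⟩ := ht.exists_ringEquiv hs
  have := (hX.mem_iff_comp_mem (FirstOrder.Ring.languageEquivEquivRingEquiv.symm σ) hσ ![t]).1 htX
  refine hsX (?_ : ![s] ∈ X)
  convert this
  ext i; fin_cases i; exact hσt.symm

end StronglyMinimal

namespace HPFormula

/-- The value of a formula depends on finitely many variables only. -/
theorem exists_finset_sat_congr (φ : HPFormula) :
    ∃ (O : Finset ℕ) (T : Finset (ℕ × ℕ)), ∀ {M : Type u} (N : HPStructure M) (v v' : ℕ → M)
      (ρ ρ' : N.RelAssignment), (∀ i ∈ O, v i = v' i) → (∀ n i, (n, i) ∈ T → ρ n i = ρ' n i) →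
      (N.Sat φ v ρ ↔ N.Sat φ v' ρ') := by
  have hterm : ∀ t : HPTerm, ∃ (O : Finset ℕ) (T : Finset (ℕ × ℕ)),
      ∀ {M : Type u} (N : HPStructure M) (v v' : ℕ → M) (ρ ρ' : N.RelAssignment),
      (∀ i ∈ O, v i = v' i) → (∀ n i, (n, i) ∈ T → ρ n i = ρ' n i) →
      N.termValue v ρ t = N.termValue v' ρ' t := by
    rintro (i | i)
    · exact ⟨{i}, ∅, fun N v v' ρ ρ' h _ => h i (by simp)⟩
    · exact ⟨∅, {(0, i)}, fun N v v' ρ ρ' _ h => congrArg N.num (h 0 i (by simp))⟩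
  choose O T hOT using hterm
  have hset : ∀ {M : Type u} (N : HPStructure M) (ρ ρ' : N.RelAssignment) (T : Finset (ℕ × ℕ))
      (n i : ℕ) (R : N.rel n), (∀ n i, (n, i) ∈ T → ρ n i = ρ' n i) →
      ∀ n' i', (n', i') ∈ T → ρ.set n i R n' i' = ρ'.set n i R n' i' := by
    intro M N ρ ρ' T n i R h n' i' hT
    by_cases hn : n' = n
    · subst hn
      by_cases hi : i' = i
      · subst hi
        simp [HPStructure.RelAssignment.set]
      · simpa [HPStructure.RelAssignment.set, hi] using h _ _ hT
    · simpa [HPStructure.RelAssignment.set, hn] using h _ _ hT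
  induction φ with
  | eq t s =>
    refine ⟨O t ∪ O s, T t ∪ T s, fun N v v' ρ ρ' h1 h2 => ?_⟩
    simp only [HPStructure.Sat]
    rw [hOT t N v v' ρ ρ' (fun i hi => h1 i (by simp [hi])) fun n i hi => h2 n i (by simp [hi]),
      hOT s N v v' ρ ρ' (fun i hi => h1 i (by simp [hi])) fun n i hi => h2 n i (by simp [hi])]
  | relEq n i j =>
    refine ⟨∅, {(n, i), (n, j)}, fun N v v' ρ ρ' h1 h2 => ?_⟩
    simp only [HPStructure.Sat]
    rw [h2 n i (by simp), h2 n j (by simp)]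
  | mem n i t =>
    refine ⟨Finset.univ.biUnion fun j => O (t j),
      insert (n, i) (Finset.univ.biUnion fun j => T (t j)), fun N v v' ρ ρ' h1 h2 => ?_⟩
    simp only [HPStructure.Sat]
    rw [h2 n i (by simp)]
    have : ∀ j, N.termValue v ρ (t j) = N.termValue v' ρ' (t j) := fun j =>
      hOT _ N v v' ρ ρ' (fun i hi => h1 i (by simpa using ⟨j, hi⟩))
        fun n i hi => h2 n i (by simpa using .inr ⟨j, hi⟩)
    simp only [this]
  | neg φ ih =>
    obtain ⟨O, T, h⟩ := ih
    exact ⟨O, T, fun N v v' ρ ρ' h1 h2 => not_congr (h N v v' ρ ρ' h1 h2)⟩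
  | and φ ψ ih1 ih2 =>
    obtain ⟨O, T, h⟩ := ih1
    obtain ⟨O', T', h'⟩ := ih2
    exact ⟨O ∪ O', T ∪ T', fun N v v' ρ ρ' h1 h2 => and_congr
      (h N v v' ρ ρ' (fun i hi => h1 i (by simp [hi])) fun n i hi => h2 n i (by simp [hi]))
      (h' N v v' ρ ρ' (fun i hi => h1 i (by simp [hi])) fun n i hi => h2 n i (by simp [hi]))⟩
  | allObj i φ ih =>
    obtain ⟨O, T, h⟩ := ih
    refine ⟨O, T, fun N v v' ρ ρ' h1 h2 => forall_congr' fun a => h _ _ _ _ _ ?_ h2⟩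
    intro j hj
    by_cases hji : j = i <;> simp [hji, h1 j hj]
  | allRel n i φ ih =>
    obtain ⟨O, T, h⟩ := ih
    exact ⟨O, T, fun N v v' ρ ρ' h1 h2 =>
      forall_congr' fun R => h _ _ _ _ _ h1 (hset N ρ ρ' T n i R h2)⟩
  | exRel n i φ ih =>
    obtain ⟨O, T, h⟩ := ih
    exact ⟨O, T, fun N v v' ρ ρ' h1 h2 =>
      exists_congr fun R => h _ _ _ _ _ h1 (hset N ρ ρ' T n i R h2)⟩

theorem IsPi11.exists_isSigma11_sat_iff_not {ψ : HPFormula} (h : ψ.IsPi11) :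
    ∃ φ : HPFormula, φ.IsSigma11 ∧ ∀ {M : Type u} (N : HPStructure M) (v : ℕ → M)
      (ρ : N.RelAssignment), N.Sat φ v ρ ↔ ¬ N.Sat ψ v ρ := by
  induction h with
  | @arith ψ h => exact ⟨neg ψ, .arith h, fun N v ρ => Iff.rfl⟩
  | all n i _ ih =>
    obtain ⟨φ, hφ, h⟩ := ih
    refine ⟨exRel n i φ, .ex n i hφ, fun N v ρ => ?_⟩
    simp only [HPStructure.Sat, h, not_forall]

end HPFormula

section Comprehension

open HPStructure

theorem Set.Definable.setOf_card_fiber_eq {L : FirstOrder.Language.{v, w}} {M : Type u}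
    [L.Structure M] {A : Set M} {β : Type*} {E : Set (β ⊕ Fin 1 → M)}
    (hE : A.Definable L E) (n : ℕ) :
    A.Definable L {p : β → M | {y : Fin 1 → M | Sum.elim p y ∈ E}.Finite ∧
      {y : Fin 1 → M | Sum.elim p y ∈ E}.ncard = n} := by
  have hinj : A.Definable L {q : β ⊕ Fin n → M | ∀ i j, q (.inr i) = q (.inr j) → i = j} := by
    simp only [Set.ofPred_forall]
    refine Set.definable_iInter_of_finite fun i => Set.definable_iInter_of_finite fun j => ?_
    by_cases hij : i = j
    · simp [hij]
    · simpa [hij] using! ((Set.DefinableFun.proj L).ofPred_eq (Set.DefinableFun.proj L)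
        (A := A) (f := fun q : β ⊕ Fin n → M => q (.inr i)) (g := fun q => q (.inr j))).compl
  have hcov : A.Definable L {q : β ⊕ Fin n → M | ∀ y : Fin 1 → M,
      Sum.elim q y ∈ {r : (β ⊕ Fin n) ⊕ Fin 1 → M |
        r ∘ Sum.map Sum.inl id ∈ E ↔ ∃ i, r (.inr 0) = r (.inl (.inr i))}} := by
    refine Set.Definable.forall_of_finite ?_
    have h1 := hE.preimage_comp (Sum.map Sum.inl id : β ⊕ Fin 1 → (β ⊕ Fin n) ⊕ Fin 1)
    have h2 : A.Definable L {r : (β ⊕ Fin n) ⊕ Fin 1 → M | ∃ i, r (.inr 0) = r (.inl (.inr i))} := by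
      simp only [Set.ofPred_exists]
      exact Set.definable_iUnion_of_finite fun i =>
        (Set.DefinableFun.proj L).ofPred_eq (Set.DefinableFun.proj L)
    convert ((h1.inter h2).union (h1.compl.inter h2.compl)) using 1
    ext r
    simp only [Set.mem_ofPred_eq, Set.mem_union, Set.mem_inter_iff, Set.mem_compl_iff,
      Set.mem_preimage]
    tauto
  convert (hinj.inter hcov).exists_of_finite using 1
  ext p
  have hmap : ∀ (u : Fin n → M) (y : Fin 1 → M),
      Sum.elim (Sum.elim p u) y ∘ Sum.map Sum.inl id = Sum.elim p y := by
    intro u y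
    funext i
    rcases i with i | i <;> rfl
  simp only [Set.mem_ofPred_eq, Set.mem_inter_iff, Sum.elim_inr, Sum.elim_inl, hmap]
  constructor
  · rintro ⟨hf, hn⟩
    have := hf.to_subtype
    let e : Fin n ≃ {y : Fin 1 → M | Sum.elim p y ∈ E} :=
      (Finite.equivFinOfCardEq (by rw [Nat.card_coe_set_eq, hn])).symm
    refine ⟨fun i => (e i).1 0, fun i j hij => e.injective (Subtype.ext ?_), fun y => ?_⟩
    · funext a; rw [Subsingleton.elim a 0]; exact hij
    · constructor
      · intro hy
        exact ⟨e.symm ⟨y, hy⟩, by simp⟩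
      · rintro ⟨i, hi⟩
        have : y = (e i).1 := by funext a; rw [Subsingleton.elim a 0]; exact hi
        rw [this]
        exact (e i).2
  · rintro ⟨u, hu, h⟩
    have : {y : Fin 1 → M | Sum.elim p y ∈ E} = Set.range fun i => ![u i] := by
      ext y
      rw [Set.mem_ofPred_eq, h y, Set.mem_range]
      refine exists_congr fun i => ⟨fun hi => ?_, fun hi => by rw [← hi]; rfl⟩
      funext a; rw [Subsingleton.elim a 0]; exact hi.symm
    rw [this]
    refine ⟨Set.finite_range _, ?_⟩
    rw [← Set.image_univ, Set.ncard_image_of_injective _ fun i j hij => hu i j (congrFun hij 0)]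
    simp [Set.ncard_univ]

theorem Set.Definable.exists_family {L : FirstOrder.Language.{v, w}} {M : Type u}
    [L.Structure M] {A : Set M} {β : Type*} {s : Set (β → M)} (hs : A.Definable L s) :
    ∃ (m : ℕ) (E : Set (Fin m ⊕ β → M)) (b : Fin m → M), (∅ : Set M).Definable L E ∧
      s = {x | Sum.elim b x ∈ E} := by
  obtain ⟨A0, -, h⟩ := Set.definable_iff_finitely_definable.1 hs
  obtain ⟨φ, rfl⟩ := Set.definable_iff_exists_formula_sum.1 h
  obtain ⟨m, ⟨e⟩⟩ := Finite.exists_equiv_fin (A0 : Set M)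
  refine ⟨m, {x | φ.Realize (x ∘ Sum.map e id)}, fun i => (e.symm i : M),
    Set.empty_definable_iff.2 ⟨φ.relabel (Sum.map e id), ?_⟩, ?_⟩
  · ext; simp [Formula.realize_relabel]
  · ext x
    simp only [Set.mem_ofPred_eq]
    have : Sum.elim (fun a : (A0 : Set M) => (a : M)) x =
        Sum.elim (fun i => (e.symm i : M)) x ∘ Sum.map e id := by
      funext i
      rcases i with i | i <;> simp
    rw [this]

variable {k : Type u} [Field k] [FirstOrder.Ring.CompatibleRing k]

theorem Set.DefinableFun.of_locally_intCast (h : Language.ring.IsDefinablyCompact k) {A : Set k}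
    (hA : A.Finite) {β : Type*} [Finite β] {f : (β → k) → k}
    (hf : ∀ p, ∃ D, A.Definable Language.ring D ∧ p ∈ D ∧ ∃ z : ℤ, ∀ q ∈ D, f q = z) :
    A.DefinableFun Language.ring f := by
  refine Set.LocallyDefinable.definable h hA ?_ ?_
  · intro w hw
    obtain ⟨D, hD, hwD, z, hz⟩ := hf (w ∘ some)
    refine ⟨_, (hD.preimage_comp some).inter ((Set.DefinableFun.proj _ (i := none)).ofPred_eq
      (Set.DefinableFun.intCast z)), ⟨hwD, ?_⟩, ?_⟩
    · rw [Set.mem_ofPred_eq, ← hz _ hwD]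
      simpa [Function.tupleGraph, eq_comm] using! hw
    · rintro x ⟨hx, hx'⟩
      simpa [Function.tupleGraph, eq_comm] using! (hz _ hx).trans hx'.symm
  · intro w hw
    obtain ⟨D, hD, hwD, z, hz⟩ := hf (w ∘ some)
    refine ⟨_, (hD.preimage_comp some).inter ((Set.DefinableFun.proj _ (i := none)).ofPred_eq
      (Set.DefinableFun.intCast z)).compl, ⟨hwD, ?_⟩, ?_⟩
    · intro hw'
      apply hw
      simpa [Function.tupleGraph, eq_comm] using! (hz _ hwD).trans hw'.symm
    · rintro x ⟨hx, hx'⟩ hxG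
      apply hx'
      rw [Set.mem_ofPred_eq, ← hz _ hx]
      simpa [Function.tupleGraph, eq_comm] using! hxG

theorem HPStructure.ofField_num_of_finite {X : (ofField k).rel 0}
    (h : (X : Set (Fin 1 → k)).Finite) :
    (ofField k).num X = ((X : Set (Fin 1 → k)).ncard : k) := by
  simp [ofField, h]

theorem HPStructure.ofField_num_of_finite_compl [Infinite k] {X : (ofField k).rel 0}
    (h : (X : Set (Fin 1 → k))ᶜ.Finite) :
    (ofField k).num X = -(((X : Set (Fin 1 → k))ᶜ.ncard : k) + 1) := by
  have : ¬ (X : Set (Fin 1 → k)).Finite := fun h' => Set.infinite_of_finite_compl h h'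
  simp [ofField, this]

/-- A family of assignments depending definably on parameters. -/
structure HPStructure.IsUniform (A : Set k) {β : Type} (v : (β → k) → ℕ → k)
    (ρ : (β → k) → (ofField k).RelAssignment) : Prop where
  obj : ∀ i, A.DefinableFun Language.ring fun p => v p i
  rel : ∀ n i, A.Definable Language.ring
    {q : β ⊕ Fin (n + 1) → k | q ∘ Sum.inr ∈ (ρ (q ∘ Sum.inl) n i : Set (Fin (n + 1) → k))}

theorem Set.DefinableFun.comp_reindex {L : FirstOrder.Language.{v, w}} {M : Type u}
    [L.Structure M] {A : Set M} {β γ : Type*} {f : (β → M) → M} (hf : A.DefinableFun L f)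
    (e : β → γ) : A.DefinableFun L fun q : γ → M => f (q ∘ e) := by
  have := Set.Definable.preimage_comp (Option.map e) hf
  simpa [Set.DefinableFun, Function.tupleGraph] using! this

theorem HPStructure.IsUniform.comp_inl {A : Set k} {β γ : Type} {v : (β → k) → ℕ → k}
    {ρ : (β → k) → (ofField k).RelAssignment} (h : IsUniform A v ρ) :
    IsUniform A (fun q : β ⊕ γ → k => v (q ∘ Sum.inl)) (fun q => ρ (q ∘ Sum.inl)) where
  obj i := (h.obj i).comp_reindex _
  rel n i := (h.rel n i).preimage_comp
    (Sum.map Sum.inl id : β ⊕ Fin (n + 1) → (β ⊕ γ) ⊕ Fin (n + 1))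

theorem HPStructure.IsUniform.update {A : Set k} {β : Type} {v : (β → k) → ℕ → k}
    {ρ : (β → k) → (ofField k).RelAssignment} (h : IsUniform A v ρ) (i : ℕ) {f : (β → k) → k}
    (hf : A.DefinableFun Language.ring f) :
    IsUniform A (fun p => Function.update (v p) i (f p)) ρ where
  obj j := by
    by_cases hj : j = i
    · subst hj; simpa using hf
    · simpa [hj] using h.obj j
  rel := h.rel

theorem HPStructure.IsUniform.set {A : Set k} {β : Type} {v : (β → k) → ℕ → k}
    {ρ : (β → k) → (ofField k).RelAssignment} (h : IsUniform A v ρ) (n i : ℕ)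
    {R : (β → k) → (ofField k).rel n} (hR : A.Definable Language.ring
      {q : β ⊕ Fin (n + 1) → k | q ∘ Sum.inr ∈ (R (q ∘ Sum.inl) : Set (Fin (n + 1) → k))}) :
    IsUniform A v (fun p => (ρ p).set n i (R p)) where
  obj := h.obj
  rel n' i' := by
    by_cases hn : n' = n
    · subst hn
      by_cases hi : i' = i
      · subst hi
        simpa [RelAssignment.set] using hR
      · simpa [RelAssignment.set, hi] using h.rel n' i'
    · simpa [RelAssignment.set, hn] using h.rel n' i'

variable [IsAlgClosed k] {A : Set k} {β : Type} {v : (β → k) → ℕ → k}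
  {ρ : (β → k) → (ofField k).RelAssignment}

theorem HPStructure.IsUniform.definableFun_num [Finite β]
    (hk : Language.ring.IsDefinablyCompact k) (hA : A.Finite)
    (h : IsUniform A v ρ) (i : ℕ) :
    A.DefinableFun Language.ring fun p => (ofField k).num (ρ p 0 i) := by
  have hE := h.rel 0 i
  have hEc := hE.compl
  refine Set.DefinableFun.of_locally_intCast hk hA fun p => ?_
  have hfib : ∀ p, {y : Fin 1 → k | Sum.elim p y ∈ {q : β ⊕ Fin (0 + 1) → k | q ∘ Sum.inr ∈
      (ρ (q ∘ Sum.inl) 0 i : Set (Fin (0 + 1) → k))}} = (ρ p 0 i : Set (Fin 1 → k)) := by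
    intro p; ext y; simp
  have hfibc : ∀ p, {y : Fin 1 → k | Sum.elim p y ∈ {q : β ⊕ Fin (0 + 1) → k | q ∘ Sum.inr ∈
      (ρ (q ∘ Sum.inl) 0 i : Set (Fin (0 + 1) → k))}ᶜ} = (ρ p 0 i : Set (Fin 1 → k))ᶜ := by
    intro p; ext y; simp
  have hρ : (Set.univ : Set k).Definable Language.ring (ρ p 0 i : Set (Fin 1 → k)) := (ρ p 0 i).2
  rcases hρ.finite_or_finite_compl hk with hf | hf
  · refine ⟨_, hE.setOf_card_fiber_eq (ρ p 0 i : Set (Fin 1 → k)).ncard, ?_,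
      (ρ p 0 i : Set (Fin 1 → k)).ncard, fun q hq => ?_⟩
    · rw [Set.mem_ofPred_eq, hfib]
      exact ⟨hf, rfl⟩
    · rw [Set.mem_ofPred_eq, hfib] at hq
      rw [ofField_num_of_finite hq.1, hq.2]
      simp
  · refine ⟨_, hEc.setOf_card_fiber_eq (ρ p 0 i : Set (Fin 1 → k))ᶜ.ncard, ?_,
      -((ρ p 0 i : Set (Fin 1 → k))ᶜ.ncard + 1), fun q hq => ?_⟩
    · rw [Set.mem_ofPred_eq, hfibc]
      exact ⟨hf, rfl⟩
    · rw [Set.mem_ofPred_eq, hfibc] at hq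
      rw [ofField_num_of_finite_compl hq.1, hq.2]
      simp

theorem HPStructure.IsUniform.definableFun_termValue [Finite β]
    (hk : Language.ring.IsDefinablyCompact k) (hA : A.Finite)
    (h : IsUniform A v ρ)
    (t : HPTerm) : A.DefinableFun Language.ring fun p => (ofField k).termValue (v p) (ρ p) t := by
  cases t with
  | var i => exact h.obj i
  | num i => exact h.definableFun_num hk hA i

theorem HPStructure.IsUniform.definable_sat [Finite β]
    (hk : Language.ring.IsDefinablyCompact k) (hA : A.Finite)
    (h : IsUniform A v ρ) {φ : HPFormula}
    (hφ : φ.IsArithmetical) : A.Definable Language.ring {p | (ofField k).Sat φ (v p) (ρ p)} := by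
  induction φ generalizing β with
  | eq t s =>
    exact (h.definableFun_termValue hk hA t).ofPred_eq (h.definableFun_termValue hk hA s)
  | relEq n i j =>
    have h1 := h.rel n i
    have h2 := h.rel n j
    convert! ((h1.inter h2).union (h1.compl.inter h2.compl)).forall_of_finite using 1
    ext p
    simp only [Set.mem_ofPred_eq, Set.mem_union, Set.mem_inter_iff, Set.mem_compl_iff, Sat,
      Sum.elim_comp_inl, Sum.elim_comp_inr, Subtype.ext_iff, Set.ext_iff]
    exact forall_congr' fun y => by tauto
  | mem n i t =>
    refine Set.Definable.preimage_map
      (F := fun p => Sum.elim p fun j => (ofField k).termValue (v p) (ρ p) (t j)) ?_ (h.rel n i)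
    rintro (j | j)
    · exact Set.DefinableFun.proj _
    · exact h.definableFun_termValue hk hA (t j)
  | neg φ ih => exact (ih h hφ).compl
  | and φ ψ ih1 ih2 => exact (ih1 h hφ.1).inter (ih2 h hφ.2)
  | allObj i φ ih =>
    have := ih ((h.comp_inl (γ := Fin 1)).update i
      (Set.DefinableFun.proj _ (i := Sum.inr 0))) hφ
    convert! this.forall_of_finite using 1
    ext p
    simp only [Set.mem_ofPred_eq, Sat, Sum.elim_comp_inl, Sum.elim_inr]
    exact ⟨fun h u => h (u 0), fun h a => h fun _ => a⟩
  | allRel n i φ ih => exact hφ.elim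
  | exRel n i φ ih => exact hφ.elim

theorem HPStructure.IsUniform.locallyDefinable_sat [Finite β]
    (hk : Language.ring.IsDefinablyCompact k) (hA : A.Finite)
    (h : IsUniform A v ρ)
    {φ : HPFormula} (hφ : φ.IsSigma11) :
    A.LocallyDefinable Language.ring {p | (ofField k).Sat φ (v p) (ρ p)} := by
  induction hφ generalizing β with
  | arith hφ => exact (h.definable_sat hk hA hφ).locallyDefinable
  | ex n i _ ih =>
    rintro p ⟨R, hR⟩
    obtain ⟨m, E, b, hE, hRE⟩ := Set.Definable.exists_family R.2
    have hsec : ∀ c : Fin m → k, (Set.univ : Set k).Definable Language.ring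
        {x : Fin (n + 1) → k | Sum.elim c x ∈ E} := fun c => by
      refine Set.Definable.preimage_map (F := fun x => Sum.elim c x) ?_
        (hE.mono (Set.empty_subset _))
      rintro (j | j)
      · exact Language.ring.definableFun_const _ (Set.mem_univ _)
      · exact Set.DefinableFun.proj _
    have hu := (h.comp_inl (γ := Fin m)).set n i
      (R := fun q => ⟨{x | Sum.elim (q ∘ Sum.inr) x ∈ E}, hsec _⟩)
      ((hE.mono (Set.empty_subset A)).preimage_comp
        (Sum.map Sum.inr id : Fin m ⊕ Fin (n + 1) → (β ⊕ Fin m) ⊕ Fin (n + 1)) |> fun h => by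
          convert! h using 1
          ext q
          simp only [Set.mem_ofPred_eq, Set.mem_preimage]
          rw [iff_eq_eq]
          congr 1
          funext j
          rcases j with j | j <;> rfl)
    obtain ⟨s, hs, hps, hsub⟩ := ih hu (Sum.elim p b) (by
      simp only [Set.mem_ofPred_eq, Sum.elim_comp_inl, Sum.elim_comp_inr, ← hRE]
      exact hR)
    refine ⟨_, hs.exists_of_finite, ⟨b, hps⟩, ?_⟩
    rintro p' ⟨b', hb'⟩
    have := hsub hb'
    simp only [Set.mem_ofPred_eq, Sum.elim_comp_inl, Sum.elim_comp_inr] at this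
    exact ⟨_, this⟩

theorem HPStructure.ofField_delta11Comprehension
    (hk : Language.ring.IsDefinablyCompact k) : (ofField k).Delta11Comprehension := by
  classical
  intro φ ψ hφ hψ n z hz v ρ hφψ
  obtain ⟨χ, hχ, hχψ⟩ := HPFormula.IsPi11.exists_isSigma11_sat_iff_not.{u} hψ
  obtain ⟨O, T, hφc⟩ := φ.exists_finset_sat_congr
  obtain ⟨O', T', hχc⟩ := χ.exists_finset_sat_congr
  let v' : ℕ → k := fun i => if i ∈ O ∪ O' then v i else 0
  let ρ' : (ofField k).RelAssignment := fun n i =>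
    if (n, i) ∈ T ∪ T' then ρ n i else ⟨∅, Set.definable_empty⟩
  have hdef : ∀ x : ℕ × ℕ, ∃ B : Finset k,
      (B : Set k).Definable Language.ring (ρ x.1 x.2 : Set (Fin (x.1 + 1) → k)) := fun x => by
    obtain ⟨B, -, hB⟩ := Set.definable_iff_finitely_definable.1 (ρ x.1 x.2).2
    exact ⟨B, hB⟩
  choose B hB using hdef
  let A : Finset k := (O ∪ O').image v ∪ (T ∪ T').biUnion B
  have hu : IsUniform (A : Set k) (fun a : Fin (n + 1) → k => Function.extend z a v')
      (fun _ => ρ') := by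
    constructor
    · intro i
      by_cases hi : ∃ j, z j = i
      · obtain ⟨j, rfl⟩ := hi
        simpa [hz.extend_apply] using! Set.DefinableFun.proj Language.ring (i := j)
      · simp only [Function.extend_apply' _ _ _ hi, v']
        split_ifs with h
        · exact Language.ring.definableFun_const _ 
            (Finset.mem_union_left _ (Finset.mem_image_of_mem v h))
        · exact Set.DefinableFun.zero
    · intro m i
      refine Set.Definable.preimage_comp (Sum.inr : Fin (m + 1) → _) (s := (ρ' m i).1) ?_
      simp only [ρ']
      split_ifs with h
      · refine (hB (m, i)).mono fun b hb => ?_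
        simp only [A, Finset.coe_union]
        right
        exact Finset.mem_biUnion.2 ⟨_, h, hb⟩
      · exact Set.definable_empty
  have hv : ∀ a : Fin (n + 1) → k, ∀ i ∈ O ∪ O',
      Function.extend z a v i = Function.extend z a v' i := by
    intro a i hi
    by_cases hj : ∃ j, z j = i
    · obtain ⟨j, rfl⟩ := hj
      simp [hz.extend_apply]
    · simp only [Function.extend_apply' _ _ _ hj, v', if_pos hi]
  have hρ : ∀ m i, (m, i) ∈ T ∪ T' → ρ m i = ρ' m i := fun m i hi => by
    simp only [ρ', if_pos hi]
  have hφ' : ∀ a, (ofField k).Sat φ (Function.extend z a v) ρ ↔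
      (ofField k).Sat φ (Function.extend z a v') ρ' := fun a =>
    hφc _ _ _ _ _ (fun i hi => hv a i (Finset.mem_union_left _ hi))
      fun m i hi => hρ m i (Finset.mem_union_left _ hi)
  have hχ' : ∀ a, (ofField k).Sat χ (Function.extend z a v) ρ ↔
      (ofField k).Sat χ (Function.extend z a v') ρ' := fun a =>
    hχc _ _ _ _ _ (fun i hi => hv a i (Finset.mem_union_right _ hi))
      fun m i hi => hρ m i (Finset.mem_union_right _ hi)
  have h1 := hu.locallyDefinable_sat hk A.finite_toSet hφ
  have h2 := hu.locallyDefinable_sat hk A.finite_toSet hχ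
  have hdef := h1.definable hk A.finite_toSet (by
    convert! h2 using 1
    ext a
    simp only [Set.mem_compl_iff, Set.mem_ofPred_eq, ← hφ', ← hχ', hχψ, hφψ])
  exact ⟨⟨_, hdef.mono (Set.subset_univ _)⟩, fun a => (hφ' a).symm⟩

end Comprehension

section AxGrothendieck

variable {L : FirstOrder.Language.{v, w}} {m : ℕ}

/-- The sentence saying that every injective function whose graph is defined by an instance
of `η` is surjective. -/
noncomputable def FirstOrder.Language.Formula.surjectiveOfInjective
    (η : L.Formula (Fin m ⊕ Fin 2)) : L.Sentence :=
  let total : L.Formula (Fin m) :=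
    ((η.relabel (Sum.elim (Sum.inl ∘ Sum.inl) ![Sum.inl (Sum.inr 0), Sum.inr 0] :
      Fin m ⊕ Fin 2 → (Fin m ⊕ Fin 1) ⊕ Fin 1)).iExs (Fin 1)).iAlls (Fin 1)
  let surj : L.Formula (Fin m) :=
    ((η.relabel (Sum.elim (Sum.inl ∘ Sum.inl) ![Sum.inr 0, Sum.inl (Sum.inr 0)] :
      Fin m ⊕ Fin 2 → (Fin m ⊕ Fin 1) ⊕ Fin 1)).iExs (Fin 1)).iAlls (Fin 1)
  let app (i j : Fin 3) : L.Formula (Fin m ⊕ Fin 3) := η.relabel (Sum.map id ![i, j])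
  let eq (i j : Fin 3) : L.Formula (Fin m ⊕ Fin 3) :=
    Term.equal (Term.var (Sum.inr i)) (Term.var (Sum.inr j))
  let func : L.Formula (Fin m) := ((app 0 1).imp ((app 0 2).imp (eq 1 2))).iAlls (Fin 3)
  let inj : L.Formula (Fin m) := ((app 0 2).imp ((app 1 2).imp (eq 0 1))).iAlls (Fin 3)
  Formula.iAlls (Fin m) ((total.imp (func.imp (inj.imp surj))).relabel Sum.inr)

theorem FirstOrder.Language.Formula.realize_surjectiveOfInjective
    (η : L.Formula (Fin m ⊕ Fin 2)) (M : Type u) [L.Structure M] :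
    M ⊨ η.surjectiveOfInjective ↔ ∀ b : Fin m → M,
      (∀ x, ∃ y, η.Realize (Sum.elim b ![x, y])) →
      (∀ x y z, η.Realize (Sum.elim b ![x, y]) → η.Realize (Sum.elim b ![x, z]) → y = z) →
      (∀ x y z, η.Realize (Sum.elim b ![x, z]) → η.Realize (Sum.elim b ![y, z]) → x = y) →
      ∀ y, ∃ x, η.Realize (Sum.elim b ![x, y]) := by
  have h1 : ∀ (b : Fin m → M) (c d : Fin 1 → M),
      Sum.elim (Sum.elim b c) d ∘ (Sum.elim (Sum.inl ∘ Sum.inl) ![Sum.inl (Sum.inr 0), Sum.inr 0] :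
        Fin m ⊕ Fin 2 → (Fin m ⊕ Fin 1) ⊕ Fin 1) = Sum.elim b ![c 0, d 0] := by
    intro b c d; funext i
    rcases i with i | i
    · rfl
    · fin_cases i <;> rfl
  have h2 : ∀ (b : Fin m → M) (c d : Fin 1 → M),
      Sum.elim (Sum.elim b c) d ∘ (Sum.elim (Sum.inl ∘ Sum.inl) ![Sum.inr 0, Sum.inl (Sum.inr 0)] :
        Fin m ⊕ Fin 2 → (Fin m ⊕ Fin 1) ⊕ Fin 1) = Sum.elim b ![d 0, c 0] := by
    intro b c d; funext i
    rcases i with i | i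
    · rfl
    · fin_cases i <;> rfl
  have h3 : ∀ (b : Fin m → M) (u : Fin 3 → M) (i j : Fin 3),
      Sum.elim b u ∘ (Sum.map id ![i, j] : Fin m ⊕ Fin 2 → _) = Sum.elim b ![u i, u j] := by
    intro b u i j; funext l
    rcases l with l | l
    · rfl
    · fin_cases l <;> rfl
  have h4 : ∀ {P : (Fin 1 → M) → Prop}, (∀ c, P c) ↔ ∀ a, P ![a] := fun {P} =>
    ⟨fun h a => h _, fun h c => by
      have : c = ![c 0] := by funext i; fin_cases i; rfl
      rw [this]; exact h _⟩
  have h5 : ∀ {P : (Fin 1 → M) → Prop}, (∃ c, P c) ↔ ∃ a, P ![a] := fun {P} =>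
    ⟨fun ⟨c, h⟩ => ⟨c 0, by
      have : c = ![c 0] := by funext i; fin_cases i; rfl
      rwa [this] at h⟩, fun ⟨a, h⟩ => ⟨_, h⟩⟩
  have h6 : ∀ {P : M → M → M → Prop},
      (∀ u : Fin 3 → M, P (u 0) (u 1) (u 2)) ↔ ∀ a b c, P a b c := fun {P} =>
    ⟨fun h a b c => h ![a, b, c], fun h u => h _ _ _⟩
  simp only [surjectiveOfInjective, Sentence.Realize, Formula.realize_iAlls,
    Formula.realize_relabel, Formula.realize_imp, Formula.realize_iExs,
    Sum.elim_comp_inr, h1, h2, h3, h4, h5, Formula.realize_equal, Term.realize_var, Sum.elim_inr,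
    Matrix.cons_val_zero]
  refine forall_congr' fun b => imp_congr_right fun _ => imp_congr ?_ (imp_congr ?_ Iff.rfl)
  · exact h6 (P := fun x y z => η.Realize (Sum.elim b ![x, y]) →
      η.Realize (Sum.elim b ![x, z]) → y = z)
  · exact h6 (P := fun x y z => η.Realize (Sum.elim b ![x, z]) →
      η.Realize (Sum.elim b ![y, z]) → x = y)

open FirstOrder.Ring FirstOrder.Field

theorem AlgebraicClosure.exists_forall_pow_eq (p : ℕ) [Fact p.Prime]
    {S : Set (AlgebraicClosure (ZMod p))} (hS : S.Finite) :
    ∃ n : ℕ, n ≠ 0 ∧ ∀ a ∈ S, a ^ p ^ n = a := by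
  let F := IntermediateField.adjoin (ZMod p) S
  have : FiniteDimensional (ZMod p) F :=
    have := hS.to_subtype
    IntermediateField.finiteDimensional_adjoin fun x _ =>
      (Algebra.IsAlgebraic.isAlgebraic x).isIntegral
  have : Finite F := Module.finite_of_finite (ZMod p)
  have : Fintype F := Fintype.ofFinite F
  obtain ⟨n, -, hn⟩ := FiniteField.card F p
  refine ⟨n, n.ne_zero, fun a ha => ?_⟩
  have := FiniteField.pow_card (⟨a, IntermediateField.subset_adjoin _ _ ha⟩ : F)
  rw [hn] at this
  exact congrArg Subtype.val this

theorem FirstOrder.Field.ACF_prime_models_surjectiveOfInjective {p : ℕ} (hp : p.Prime)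
    (η : Language.ring.Formula (Fin m ⊕ Fin 2)) :
    Theory.ACF p ⊨ᵇ η.surjectiveOfInjective := by
  classical
  have : Fact p.Prime := ⟨hp⟩
  let K := AlgebraicClosure (ZMod p)
  let _ := compatibleRingOfRing K
  rw [← (ACF_isComplete (Or.inl hp)).realize_sentence_iff _ K,
    Formula.realize_surjectiveOfInjective]
  intro b htot hfun hinj y
  obtain ⟨n, hn, hS⟩ := AlgebraicClosure.exists_forall_pow_eq p
    ((Set.finite_range b).insert y)
  choose f hf using htot
  let σ : K ≃+* K := iterateFrobeniusEquiv K p n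
  have hσ : ∀ x, σ x = x ^ p ^ n := fun x => iterateFrobeniusEquiv_def K p n x
  let F : Set K := {x | σ x = x}
  have hF : F.Finite := by
    refine ((Polynomial.X ^ p ^ n - Polynomial.X :
      Polynomial K).roots.toFinset.finite_toSet).subset fun x hx => ?_
    have hne := FiniteField.X_pow_card_pow_sub_X_ne_zero K hn hp.one_lt
    have : x ^ p ^ n = x := (hσ x).symm.trans hx
    simp [hne, this]
  have hmaps : Set.MapsTo f F F := by
    intro x hx
    have h1 := (StrongHomClass.realize_formula (languageEquivEquivRingEquiv.symm σ) η).2 (hf x)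
    have h2 : (languageEquivEquivRingEquiv.symm σ : Language.ring.Equiv K K) ∘
        Sum.elim b ![x, f x] = Sum.elim b ![x, σ (f x)] := by
      funext i
      rcases i with i | i
      · exact (hσ _).trans (hS _ (by simp))
      · fin_cases i
        · exact hx
        · rfl
    rw [h2] at h1
    exact hfun _ _ _ h1 (hf x)
  have hinjF : Set.InjOn f F := fun x _ x' _ hxx => hinj _ _ _ (hf x) (hxx ▸ hf x')
  have hy : y ∈ F := (hσ y).trans (hS y (by simp))
  have := hF.to_subtype
  obtain ⟨x, hx⟩ := Finite.surjective_of_injective (hmaps.restrict_inj.2 hinjF) ⟨y, hy⟩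
  have hx : f x = y := congrArg Subtype.val hx
  exact ⟨x, hx ▸ hf x⟩

/-- An injective definable function from an algebraically closed field to itself is surjective. -/
theorem Function.Injective.surjective_of_definable {k : Type u} [Field k] [CompatibleRing k]
    [IsAlgClosed k] {f : k → k} (hf : Function.Injective f) {A : Set k}
    (hdef : A.Definable Language.ring {w : Fin 2 → k | w 1 = f (w 0)}) :
    Function.Surjective f := by
  obtain ⟨m, E, b, hE, hEb⟩ := hdef.exists_family
  obtain ⟨η, rfl⟩ := Set.empty_definable_iff.1 hE
  have key : ∀ {p : ℕ}, p.Prime ∨ p = 0 → Theory.ACF p ⊨ᵇ η.surjectiveOfInjective := by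
    rintro p (hp | rfl)
    · exact ACF_prime_models_surjectiveOfInjective hp η
    · rw [ACF_zero_realize_iff_infinite_ACF_prime_realize]
      convert Set.infinite_univ (α := Nat.Primes)
      exact Set.eq_univ_of_forall fun p => ACF_prime_models_surjectiveOfInjective p.2 η
  have hp := CharP.char_is_prime_or_zero k (ringChar k)
  have h := key hp
  rw [← (ACF_isComplete hp).realize_sentence_iff _ k, Formula.realize_surjectiveOfInjective] at h
  have hη : ∀ x y, η.Realize (Sum.elim b ![x, y]) ↔ y = f x := fun x y =>
    (Set.ext_iff.1 hEb ![x, y]).symm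
  replace h := h b
  simp only [hη] at h
  intro y
  obtain ⟨x, hx⟩ := h (fun x => ⟨_, rfl⟩) (fun x y z hy hz => hy.trans hz.symm)
    (fun x y z hx hy => hf (hx.symm.trans hy)) y
  exact ⟨x, hx.symm⟩

end AxGrothendieck

namespace HPStructure

section Numbers

theorem _root_.Set.finite_preimage_equiv {α β : Type*} (e : α ≃ β) {S : Set β} :
    (e ⁻¹' S).Finite ↔ S.Finite :=
  ⟨fun h => by simpa using h.image e, fun h => h.preimage e.injective.injOn⟩

variable {k : Type u} [Field k] [FirstOrder.Ring.CompatibleRing k]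

/-- The elements of a set of the structure. -/
def carrier {M : Type u} {N : HPStructure M} (X : N.rel 0) : Set M := {x | N.Mem x X}

theorem coe_eq_preimage_carrier {M : Type u} {N : HPStructure M} (X : N.rel 0) :
    (X : Set (Fin 1 → M)) = Equiv.funUnique (Fin 1) M ⁻¹' carrier X := by
  ext x
  have : x = ![x 0] := by funext i; fin_cases i; rfl
  rw [this]
  rfl

theorem finite_carrier {M : Type u} {N : HPStructure M} (X : N.rel 0) :
    (X : Set (Fin 1 → M)).Finite ↔ (carrier X).Finite := by
  rw [coe_eq_preimage_carrier]
  exact Set.finite_preimage_equiv _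

theorem finite_compl_carrier {M : Type u} {N : HPStructure M} (X : N.rel 0) :
    (X : Set (Fin 1 → M))ᶜ.Finite ↔ (carrier X)ᶜ.Finite := by
  rw [coe_eq_preimage_carrier, ← Set.preimage_compl]
  exact Set.finite_preimage_equiv _

theorem num_of_finite_carrier {X : (ofField k).rel 0} (h : (carrier X).Finite) :
    (ofField k).num X = ((carrier X).ncard : k) := by
  rw [ofField_num_of_finite ((finite_carrier X).2 h), coe_eq_preimage_carrier,
    Set.ncard_preimage_of_injective_subset_range (Equiv.injective _) (by simp)]

theorem num_of_finite_compl_carrier [Infinite k] {X : (ofField k).rel 0}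
    (h : (carrier X)ᶜ.Finite) :
    (ofField k).num X = -(((carrier X)ᶜ.ncard : k) + 1) := by
  rw [ofField_num_of_finite_compl ((finite_compl_carrier X).2 h), coe_eq_preimage_carrier,
    ← Set.preimage_compl,
    Set.ncard_preimage_of_injective_subset_range (Equiv.injective _) (by simp)]

theorem exists_carrier_eq_of_finite {S : Set k} (h : S.Finite) :
    ∃ X : (ofField k).rel 0, carrier X = S := by
  refine ⟨⟨{x | x 0 ∈ S}, ?_⟩, rfl⟩
  exact Set.Finite.definable_univ ((Set.finite_preimage_equiv (Equiv.funUnique (Fin 1) k)).2 h)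

theorem exists_carrier_eq_of_finite_compl {S : Set k} (h : Sᶜ.Finite) :
    ∃ X : (ofField k).rel 0, carrier X = S := by
  refine ⟨⟨{x | x 0 ∈ S}, ?_⟩, rfl⟩
  have : (Set.univ : Set k).Definable Language.ring {x : Fin 1 → k | x 0 ∈ S}ᶜ :=
    Set.Finite.definable_univ ((Set.finite_preimage_equiv (Equiv.funUnique (Fin 1) k)).2 h)
  have := this.compl
  rwa [compl_compl] at this

theorem isZero_iff {n : k} : (ofField k).IsZero n ↔ n = 0 := by
  constructor
  · rintro ⟨E, hE, rfl⟩
    have : carrier E = ∅ := Set.eq_empty_of_forall_notMem hE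
    rw [num_of_finite_carrier (by simp [this])]
    simp [this]
  · rintro rfl
    obtain ⟨E, hE⟩ := exists_carrier_eq_of_finite (k := k) Set.finite_empty
    refine ⟨E, fun x hx => ?_, ?_⟩
    · have : x ∈ carrier E := hx
      simp [hE] at this
    · rw [num_of_finite_carrier (by simp [hE])]
      simp [hE]

theorem exists_isBijection_of_bijOn {X Y : (ofField k).rel 0} {g : k → k}
    (hg : Set.BijOn g (carrier X) (carrier Y))
    (hd : (Set.univ : Set k).Definable Language.ring
      {w : Fin 2 → k | w 0 ∈ carrier X ∧ w 1 = g (w 0)}) :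
    ∃ f : (ofField k).rel 1, (ofField k).IsBijection f X Y := by
  refine ⟨⟨_, hd⟩, ?_, ?_, ?_⟩
  · rintro x y ⟨hx, hy⟩
    exact ⟨hx, (show y = g x from hy) ▸ hg.mapsTo hx⟩
  · intro x hx
    exact ⟨g x, ⟨hx, rfl⟩, fun y hy => hy.2⟩
  · intro y hy
    obtain ⟨x, hx, rfl⟩ := hg.surjOn hy
    exact ⟨x, ⟨hx, rfl⟩, fun x' hx' => hg.injOn hx'.1 hx hx'.2.symm⟩

theorem definable_graph_of_finite {S : Set k} (hS : S.Finite) (g : k → k) :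
    (Set.univ : Set k).Definable Language.ring {w : Fin 2 → k | w 0 ∈ S ∧ w 1 = g (w 0)} := by
  refine Set.Finite.definable_univ ((hS.image fun x => ![x, g x]).subset ?_)
  rintro w ⟨h0, h1⟩
  refine ⟨w 0, h0, ?_⟩
  funext i
  fin_cases i
  · rfl
  · exact h1.symm

theorem exists_isBijection_of_ncard_eq {X Y : (ofField k).rel 0} (hX : (carrier X).Finite)
    (hY : (carrier Y).Finite) (h : (carrier X).ncard = (carrier Y).ncard) :
    ∃ f : (ofField k).rel 1, (ofField k).IsBijection f X Y := by
  obtain ⟨g, hg⟩ := hX.exists_bijOn_of_encard_eq (t := carrier Y)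
    (by rw [← hX.cast_ncard_eq, ← hY.cast_ncard_eq, h])
  exact exists_isBijection_of_bijOn hg (definable_graph_of_finite hX g)

theorem exists_isBijection_of_ncard_compl_eq {X Y : (ofField k).rel 0}
    (hX : (carrier X)ᶜ.Finite) (hY : (carrier Y)ᶜ.Finite)
    (h : (carrier X)ᶜ.ncard = (carrier Y)ᶜ.ncard) :
    ∃ f : (ofField k).rel 1, (ofField k).IsBijection f X Y := by
  classical
  have h1 := Set.ncard_inter_add_ncard_sdiff_eq_ncard (carrier X)ᶜ (carrier Y)ᶜ hX
  have h2 := Set.ncard_inter_add_ncard_sdiff_eq_ncard (carrier Y)ᶜ (carrier X)ᶜ hY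
  rw [Set.inter_comm] at h2
  have hsd : ∀ S T : Set k, Sᶜ \ Tᶜ = T \ S := fun S T => by ext; simp [and_comm]
  have hYX : (carrier Y \ carrier X).Finite := hX.subset fun x hx => hx.2
  have hXY : (carrier X \ carrier Y).Finite := hY.subset fun x hx => hx.2
  rw [hsd] at h1 h2
  obtain ⟨g, hg⟩ := hXY.exists_bijOn_of_encard_eq (t := carrier Y \ carrier X)
    (by rw [← hXY.cast_ncard_eq, ← hYX.cast_ncard_eq]; congr 1; omega)
  refine exists_isBijection_of_bijOn (g := fun x => if x ∈ carrier Y then x else g x)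
    ⟨?_, ?_, ?_⟩ ?_
  · intro x hx
    by_cases hxY : x ∈ carrier Y
    · simp [hxY]
    · simpa [hxY] using (hg.mapsTo ⟨hx, hxY⟩).1
  · intro x hx x' hx' hxx
    by_cases hxY : x ∈ carrier Y <;> by_cases hxY' : x' ∈ carrier Y <;>
      simp only [hxY, hxY', if_true, if_false] at hxx
    · exact hxx
    · exact absurd (hxx ▸ hx) (hg.mapsTo ⟨hx', hxY'⟩).2
    · exact absurd (hxx ▸ hx') (hg.mapsTo ⟨hx, hxY⟩).2
    · exact hg.injOn ⟨hx, hxY⟩ ⟨hx', hxY'⟩ hxx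
  · intro y hy
    by_cases hyX : y ∈ carrier X
    · exact ⟨y, hyX, by simp [hy]⟩
    · obtain ⟨x, hx, rfl⟩ := hg.surjOn ⟨hy, hyX⟩
      exact ⟨x, hx.1, by simp [hx.2]⟩
  · have hcar : ∀ Z : (ofField k).rel 0, (Set.univ : Set k).Definable Language.ring
        {w : Fin 2 → k | w 0 ∈ carrier Z} := fun Z => by
      have hZ : (Set.univ : Set k).Definable Language.ring (Z : Set (Fin 1 → k)) := Z.2
      convert hZ.preimage_comp (fun _ : Fin 1 => (0 : Fin 2)) using 1
      rw [coe_eq_preimage_carrier]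
      rfl
    convert (((hcar X).inter (hcar Y)).inter ((Set.DefinableFun.proj _ (i := 1)).ofPred_eq
      (Set.DefinableFun.proj _ (i := 0)))).union (definable_graph_of_finite hXY g) using 1
    ext w
    by_cases hw : w 0 ∈ carrier Y <;> simp [hw]

theorem IsBijection.exists_symm {X Y : (ofField k).rel 0} {f : (ofField k).rel 1}
    (hf : (ofField k).IsBijection f X Y) :
    ∃ f' : (ofField k).rel 1, (ofField k).IsBijection f' Y X := by
  have hfd : (Set.univ : Set k).Definable Language.ring (f : Set (Fin 2 → k)) := f.2
  have hsw : ∀ x y, ![x, y] ∈ (fun w : Fin 2 → k => w ∘ ![1, 0]) ⁻¹' (f : Set (Fin 2 → k)) ↔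
      ![y, x] ∈ (f : Set (Fin 2 → k)) := fun x y => by
    have : ![x, y] ∘ ![1, 0] = ![y, x] := by funext i; fin_cases i <;> rfl
    rw [Set.mem_preimage, this]
  refine ⟨⟨_, hfd.preimage_comp ![1, 0]⟩, ?_⟩
  obtain ⟨h1, h2, h3⟩ := hf
  simp only [IsBijection, hsw]
  exact ⟨fun x y h => (h1 y x h).symm, h3, h2⟩

variable [IsAlgClosed k]

theorem carrier_finite_or (hk : Language.ring.IsDefinablyCompact k) (X : (ofField k).rel 0) :
    (carrier X).Finite ∨ (carrier X)ᶜ.Finite := by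
  rw [← finite_carrier, ← finite_compl_carrier]
  exact Set.Definable.finite_or_finite_compl hk X.2

theorem precedes_iff (hk : Language.ring.IsDefinablyCompact k) {n m : k} :
    (ofField k).Precedes n m ↔
      (∃ c : ℕ, n = c ∧ m = c + 1) ∨ ∃ c : ℕ, n = -(c + 2) ∧ m = -(c + 1) := by
  classical
  constructor
  · rintro ⟨X, Y, rfl, rfl, y, hy, h⟩
    have hX : carrier X = carrier Y \ {y} := by
      ext x; exact h x
    have hyY : y ∈ carrier Y := hy
    rcases carrier_finite_or hk Y with hY | hY
    · left
      refine ⟨(carrier X).ncard, num_of_finite_carrier (hX ▸ hY.sdiff), ?_⟩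
      rw [num_of_finite_carrier hY, hX, ← Set.ncard_sdiff_singleton_add_one hyY hY]
      simp
    · right
      have hXc : (carrier X)ᶜ = insert y (carrier Y)ᶜ := by
        rw [hX]; ext x; by_cases hxy : x = y <;> simp [hxy]
      refine ⟨(carrier Y)ᶜ.ncard, ?_, num_of_finite_compl_carrier hY⟩
      rw [num_of_finite_compl_carrier (hXc ▸ hY.insert y), hXc,
        Set.ncard_insert_of_notMem (by simpa using hyY) hY]
      push_cast; ring
  · rintro (⟨c, rfl, rfl⟩ | ⟨c, rfl, rfl⟩)
    · obtain ⟨t, ht⟩ := Infinite.exists_subset_card_eq k (c + 1)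
      obtain ⟨y, hy⟩ : t.Nonempty := Finset.card_pos.1 (by omega)
      obtain ⟨Y, hY⟩ := exists_carrier_eq_of_finite t.finite_toSet
      obtain ⟨X, hX⟩ := exists_carrier_eq_of_finite (t.erase y).finite_toSet
      refine ⟨X, Y, ?_, ?_, y, ?_, fun x => ?_⟩
      · rw [num_of_finite_carrier (hX ▸ Finset.finite_toSet _), hX, Set.ncard_coe_finset,
          Finset.card_erase_of_mem hy, ht]
        simp
      · rw [num_of_finite_carrier (hY ▸ Finset.finite_toSet _), hY, Set.ncard_coe_finset, ht]
        simp
      · change y ∈ carrier Y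
        simpa [hY] using hy
      · change x ∈ carrier X ↔ x ∈ carrier Y ∧ _
        simp [hX, hY, and_comm]
    · obtain ⟨t, ht⟩ := Infinite.exists_subset_card_eq k (c + 1)
      obtain ⟨y, hy⟩ : t.Nonempty := Finset.card_pos.1 (by omega)
      obtain ⟨Y, hY⟩ := exists_carrier_eq_of_finite_compl (S := ((t.erase y : Finset k) : Set k)ᶜ)
        (by rw [compl_compl]; exact Finset.finite_toSet _)
      obtain ⟨X, hX⟩ := exists_carrier_eq_of_finite_compl (S := (t : Set k)ᶜ)
        (by rw [compl_compl]; exact Finset.finite_toSet _)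
      refine ⟨X, Y, ?_, ?_, y, ?_, fun x => ?_⟩
      · rw [num_of_finite_compl_carrier (by rw [hX, compl_compl]; exact Finset.finite_toSet _), hX,
          compl_compl, Set.ncard_coe_finset, ht]
        push_cast; ring
      · rw [num_of_finite_compl_carrier (by rw [hY, compl_compl]; exact Finset.finite_toSet _), hY,
          compl_compl, Set.ncard_coe_finset, Finset.card_erase_of_mem hy, ht]
        simp
      · change y ∈ carrier Y
        simp [hY]
      · change x ∈ carrier X ↔ x ∈ carrier Y ∧ _
        by_cases hxy : x = y <;> simp [hX, hY, hxy, hy]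

theorem isPseudoNumber_iff [CharZero k] (hk : Language.ring.IsDefinablyCompact k) {a : k} :
    (ofField k).IsPseudoNumber a ↔ ∃ z : ℤ, a = z := by
  constructor
  · rintro (h | h)
    · exact ⟨0, by simpa using isZero_iff.1 h⟩
    · by_contra hno
      push Not at hno
      obtain ⟨F, hF⟩ := exists_carrier_eq_of_finite_compl (S := ({a} : Set k)ᶜ) (by simp)
      have hmem : ∀ x, (ofField k).Mem x F ↔ x ≠ a := fun x => by
        change x ∈ carrier F ↔ _
        simp [hF]
      have hP : ∀ n m, (ofField k).Precedes n m → (ofField k).Mem m F := by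
        intro n m hnm
        rw [hmem]
        rintro rfl
        rcases (precedes_iff hk).1 hnm with ⟨c, -, h⟩ | ⟨c, -, h⟩
        · exact hno (c + 1) (by simpa using h)
        · exact hno (-(c + 1)) (by simpa using h)
      exact (hmem a).1 (h F (fun n m _ => hP n m) fun z m _ => hP z m) rfl
  · rintro ⟨z, rfl⟩
    by_cases hz : z = 0
    · subst hz
      exact .inl (isZero_iff.2 (by simp))
    refine .inr fun F hF hc => ?_
    have hpos : ∀ c : ℕ, (ofField k).Mem ((c : k) + 1) F := by
      intro c
      induction c with
      | zero => exact hc 0 _ (isZero_iff.2 rfl) ((precedes_iff hk).2 (.inl ⟨0, by simp, by simp⟩))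
      | succ c ih =>
        exact hF _ _ ih ((precedes_iff hk).2 (.inl ⟨c + 1, by simp, by simp⟩))
    have hFc : (carrier F)ᶜ.Finite := by
      refine (carrier_finite_or hk F).resolve_left ?_
      refine Set.infinite_of_injective_forall_mem (f := fun c : ℕ => (c : k) + 1) ?_ hpos
      intro c d hcd
      simpa using hcd
    have hinj : Function.Injective fun c : ℕ => -((c : k) + 1) := by
      intro c d hcd
      simpa using hcd
    obtain ⟨B, hB⟩ := (hFc.preimage hinj.injOn).bddAbove
    have hlarge : ∀ c : ℕ, B < c → (ofField k).Mem (-((c : k) + 1)) F := by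
      intro c hc
      by_contra hn
      exact absurd (hB (show c ∈ _ from hn)) (by omega)
    have hneg : ∀ c d : ℕ, B < c + d → (ofField k).Mem (-((c : k) + 1)) F := by
      intro c d
      induction d generalizing c with
      | zero => exact hlarge c
      | succ d ih =>
        intro h
        refine hF _ _ (ih (c + 1) (by omega)) ((precedes_iff hk).2 (.inr ⟨c, ?_, rfl⟩))
        push_cast; ring
    rcases lt_or_gt_of_ne hz with h | h
    · obtain ⟨c, hc⟩ := Int.eq_ofNat_of_zero_le (a := -z - 1) (by omega)
      have : (z : k) = -((c : k) + 1) := by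
        have : z = -((c : ℤ) + 1) := by omega
        rw [this]; push_cast; ring
      rw [this]
      exact hneg c (B + 1) (by omega)
    · obtain ⟨c, hc⟩ := Int.eq_ofNat_of_zero_le (a := z - 1) (by omega)
      have : (z : k) = (c : k) + 1 := by
        have : z = (c : ℤ) + 1 := by omega
        rw [this]; push_cast; ring
      rw [this]
      exact hpos c

theorem not_precedes_neg_one [CharZero k] (hk : Language.ring.IsDefinablyCompact k) (m : k) :
    ¬ (ofField k).Precedes (-1) m := by
  intro h
  rcases (precedes_iff hk).1 h with ⟨c, h, -⟩ | ⟨c, h, -⟩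
  · have : ((c + 1 : ℕ) : k) = 0 := by push_cast; rw [← h]; ring
    exact absurd this (Nat.cast_ne_zero.2 (by omega))
  · have : ((c + 1 : ℕ) : k) = 0 := by push_cast; linear_combination h
    exact absurd this (Nat.cast_ne_zero.2 (by omega))

theorem not_successorAxiom_ofField [CharZero k] (hk : Language.ring.IsDefinablyCompact k) :
    ¬ (ofField k).SuccessorAxiom := by
  intro h
  obtain ⟨m, hm⟩ := h (-1) ((isPseudoNumber_iff hk).2 ⟨-1, by simp⟩)
  exact not_precedes_neg_one hk m hm

/-- A definable bijection between cofinite sets does not decrease the size of the complement. -/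
theorem IsBijection.ncard_compl_le {X Y : (ofField k).rel 0} {f : (ofField k).rel 1}
    (hf : (ofField k).IsBijection f X Y) (hX : (carrier X)ᶜ.Finite) (hY : (carrier Y)ᶜ.Finite) :
    (carrier Y)ᶜ.ncard ≤ (carrier X)ᶜ.ncard := by
  classical
  by_contra hlt
  obtain ⟨g, hgm, hgi⟩ := hX.exists_injOn_of_encard_le (t := (carrier Y)ᶜ)
    (by rw [← hX.cast_ncard_eq, ← hY.cast_ncard_eq]; exact_mod_cast (not_le.1 hlt).le)
  obtain ⟨h1, h2, h3⟩ := hf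
  have h2' : ∀ x, ∃ y, x ∈ carrier X → ![x, y] ∈ (f : Set (Fin 2 → k)) := fun x => by
    by_cases hx : x ∈ carrier X
    · obtain ⟨y, hy, -⟩ := h2 x hx
      exact ⟨y, fun _ => hy⟩
    · exact ⟨0, fun h => absurd h hx⟩
  choose h hh using h2'
  have hhY : ∀ x ∈ carrier X, h x ∈ carrier Y := fun x hx => (h1 _ _ (hh x hx)).2
  let F : k → k := fun x => if x ∈ carrier X then h x else g x
  have hFinj : Function.Injective F := by
    intro x x' hxx
    by_cases hx : x ∈ carrier X <;> by_cases hx' : x' ∈ carrier X <;>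
      simp only [F, hx, hx', if_true, if_false] at hxx
    · exact (h3 (h x) (hhY x hx)).unique (hh x hx) (hxx ▸ hh x' hx')
    · exact absurd (hxx ▸ hhY x hx) (hgm hx')
    · exact absurd (hxx ▸ hhY x' hx') (hgm hx)
    · exact hgi hx hx' hxx
  have hFdef : (Set.univ : Set k).Definable Language.ring {w : Fin 2 → k | w 1 = F (w 0)} := by
    have hfd : (Set.univ : Set k).Definable Language.ring (f : Set (Fin 2 → k)) := f.2
    convert hfd.union (definable_graph_of_finite hX g) using 1
    ext w
    have hw : w = ![w 0, w 1] := by funext i; fin_cases i <;> rfl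
    simp only [Set.mem_ofPred_eq, Set.mem_union, Set.mem_compl_iff]
    by_cases hx : w 0 ∈ carrier X
    · simp only [F, hx, if_true, not_true_eq_false, false_and, or_false]
      constructor
      · intro hw1
        rw [hw, hw1]
        exact hh _ hx
      · intro hwf
        rw [hw] at hwf
        exact (h2 _ hx).unique hwf (hh _ hx)
    · simp only [F, hx, if_false, not_false_eq_true, true_and]
      refine ⟨.inr, ?_⟩
      rintro (hwf | hw1)
      · rw [hw] at hwf
        exact absurd (h1 _ _ hwf).1 hx
      · exact hw1
  refine hlt ((Set.ncard_le_ncard (t := g '' (carrier X)ᶜ) ?_ (hX.image g)).trans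
    (Set.ncard_image_le hX))
  intro y hy
  obtain ⟨x, rfl⟩ := hFinj.surjective_of_definable hFdef y
  by_cases hx : x ∈ carrier X
  · exact absurd (by simpa [F, hx] using hhY x hx) hy
  · exact ⟨x, hx, by simp [F, hx]⟩

theorem IsBijection.exists_equiv {M : Type u} {N : HPStructure M} {X Y : N.rel 0} {f : N.rel 1}
    (hf : N.IsBijection f X Y) : Nonempty (carrier X ≃ carrier Y) := by
  obtain ⟨h1, h2, h3⟩ := hf
  choose g hg hg' using h2
  refine ⟨Equiv.ofBijective (fun x => ⟨g x.1 x.2, (h1 _ _ (hg x.1 x.2)).2⟩) ⟨?_, ?_⟩⟩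
  · intro x x' hxx
    have : g x.1 x.2 = g x'.1 x'.2 := congrArg Subtype.val hxx
    exact Subtype.ext ((h3 _ (h1 _ _ (hg x.1 x.2)).2).unique (hg _ _) (this ▸ hg x'.1 x'.2))
  · rintro ⟨y, hy⟩
    obtain ⟨x, hx, -⟩ := h3 y hy
    exact ⟨⟨x, (h1 _ _ hx).1⟩, Subtype.ext (hg' x _ y hx).symm⟩

theorem ofField_humesPrinciple [CharZero k] (hk : Language.ring.IsDefinablyCompact k) :
    (ofField k).HumesPrinciple := by
  intro X Y
  have hne : ∀ m n : ℕ, (m : k) ≠ -((n : k) + 1) := by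
    intro m n h
    have : ((m + n + 1 : ℕ) : k) = 0 := by push_cast; rw [h]; ring
    exact absurd this (Nat.cast_ne_zero.2 (by omega))
  constructor
  · intro h
    rcases carrier_finite_or hk X with hX | hX <;> rcases carrier_finite_or hk Y with hY | hY
    · rw [num_of_finite_carrier hX, num_of_finite_carrier hY] at h
      exact exists_isBijection_of_ncard_eq hX hY (by exact_mod_cast h)
    · rw [num_of_finite_carrier hX, num_of_finite_compl_carrier hY] at h
      exact absurd h (hne _ _)
    · rw [num_of_finite_compl_carrier hX, num_of_finite_carrier hY] at h
      exact absurd h.symm (hne _ _)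
    · rw [num_of_finite_compl_carrier hX, num_of_finite_compl_carrier hY] at h
      exact exists_isBijection_of_ncard_compl_eq hX hY (by simpa using h)
  · rintro ⟨f, hf⟩
    obtain ⟨e⟩ := hf.exists_equiv
    have hfin : (carrier X).Finite ↔ (carrier Y).Finite := e.set_finite_iff
    by_cases hX : (carrier X).Finite
    · rw [num_of_finite_carrier hX, num_of_finite_carrier (hfin.1 hX), Set.ncard_congr' e]
    · have hXc := (carrier_finite_or hk X).resolve_left hX
      have hYc := (carrier_finite_or hk Y).resolve_left (mt hfin.2 hX)
      obtain ⟨f', hf'⟩ := hf.exists_symm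
      rw [num_of_finite_compl_carrier hXc, num_of_finite_compl_carrier hYc,
        le_antisymm (hf'.ncard_compl_le hYc hXc) (hf.ncard_compl_le hXc hYc)]

theorem ofField_modelsDelta11HP [CharZero k] (hk : Language.ring.IsDefinablyCompact k) :
    (ofField k).ModelsDelta11HP :=
  ⟨ofField_humesPrinciple hk, ofField_delta11Comprehension hk⟩

end Numbers

end HPStructure

section Ultrapower

open Filter

theorem FirstOrder.Language.countable_formula {L : FirstOrder.Language.{v, w}}
    (hL : L.card ≤ Cardinal.aleph0) (α : Type*) [Countable α] : Countable (L.Formula α) := by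
  have h := BoundedFormula.card_le (L := L) (α := α)
  have h2 : Countable (Σ n, L.BoundedFormula α n) := by
    rw [← Cardinal.mk_le_aleph0_iff]
    refine h.trans (max_le le_rfl ?_)
    refine Cardinal.add_le_aleph0.2 ⟨?_, ?_⟩
    · rw [Cardinal.lift_le_aleph0, Cardinal.mk_le_aleph0_iff]; infer_instance
    · rwa [Cardinal.lift_le_aleph0]
  exact Function.Injective.countable (f := fun φ : L.Formula α =>
    (⟨0, φ⟩ : Σ n, L.BoundedFormula α n)) fun φ ψ h => by simpa using h

/-- Ultrapowers over a nonprincipal ultrafilter on `ℕ` in a countable language are definably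
compact. -/
theorem FirstOrder.Language.isDefinablyCompact_hyperfilter_product {L : FirstOrder.Language.{v, w}}
    (hL : L.card ≤ Cardinal.aleph0) (K : Type u) [L.Structure K] [Nonempty K] :
    L.IsDefinablyCompact ((hyperfilter ℕ : Filter ℕ).Product fun _ : ℕ => K) := by
  classical
  let U := (hyperfilter ℕ : Filter ℕ).Product fun _ : ℕ => K
  let q : (ℕ → K) → U := fun f => Quotient.mk _ f
  intro A hA n C hC hcov
  have := hA.to_subtype
  by_contra hno
  push Not at hno
  have hne : C.Nonempty := by
    by_contra hemp
    rw [Set.not_nonempty_iff_eq_empty] at hemp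
    exact hno ∅ (Set.empty_subset _) Set.finite_empty (hemp ▸ hcov)
  have hform : ∀ s : C, ∃ φ : L.Formula (A ⊕ Fin n),
      (s : Set (Fin n → U)) = {x | φ.Realize (Sum.elim (↑) x)} :=
    fun s => Set.definable_iff_exists_formula_sum.1 (hC s s.2)
  choose Φ hΦ using hform
  have hcount : C.Countable := by
    have := countable_formula hL (A ⊕ Fin n)
    refine Function.Injective.countable (f := Φ) fun s t hst => Subtype.ext ?_
    rw [hΦ s, hΦ t, hst]
  obtain ⟨s, rfl⟩ := hcount.exists_eq_range hne
  let φ : ℕ → L.Formula (A ⊕ Fin n) := fun j => Φ ⟨s j, j, rfl⟩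
  have hφ : ∀ j, s j = {x | (φ j).Realize (Sum.elim (↑) x)} := fun j => hΦ ⟨s j, j, rfl⟩
  have hrep : ∀ x : U, ∃ f : ℕ → K, q f = x := Quotient.exists_rep
  choose r hr using hrep
  let a : A → ℕ → K := fun x => r x
  have hLos : ∀ (j : ℕ) (b : Fin n → ℕ → K),
      (fun i => q (b i)) ∈ s j ↔
        ∀ᶠ m in (hyperfilter ℕ : Filter ℕ),
          (φ j).Realize (Sum.elim (fun x => a x m) fun i => b i m) := by
    intro j b
    have h := Ultraproduct.realize_formula_cast (u := hyperfilter ℕ) (M := fun _ : ℕ => K) (φ j)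
      (Sum.elim a b)
    have h1 : (fun i => q (Sum.elim a b i)) =
        Sum.elim (fun x : A => (x : U)) fun i => q (b i) := by
      funext i
      rcases i with i | i
      · exact hr i
      · rfl
    have h2 : ∀ m, (fun i => Sum.elim a b i m) = Sum.elim (fun x => a x m) fun i => b i m := by
      intro m; funext i
      rcases i with i | i <;> rfl
    simp only [h2] at h
    rw [← h, hφ j, Set.mem_ofPred_eq, ← h1]
    rfl
  let P : ℕ → ℕ → Prop := fun m i => ∃ b : Fin n → K,
    ∀ j ≤ i, ¬ (φ j).Realize (Sum.elim (fun x => a x m) b)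
  have hP : ∀ i, ∀ᶠ m in (hyperfilter ℕ : Filter ℕ), P m i := by
    intro i
    have hi := hno (s '' Set.Iic i) (Set.image_subset_range _ _) ((Set.finite_Iic i).image _)
    obtain ⟨b, hb⟩ := (Set.ne_univ_iff_exists_notMem _).1 hi
    have hb' : ∀ j ∈ Set.Iic i, ∀ᶠ m in (hyperfilter ℕ : Filter ℕ),
        ¬ (φ j).Realize (Sum.elim (fun x => a x m) fun l => r (b l) m) := by
      intro j hj
      rw [Ultrafilter.eventually_not, ← hLos j fun l => r (b l)]
      intro hbs
      refine hb ⟨s j, ⟨j, hj, rfl⟩, ?_⟩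
      rwa [show (fun i => q (r (b i))) = b from funext fun i => hr (b i)] at hbs
    filter_upwards [(eventually_all_finite (Set.finite_Iic i)).2 hb'] with m hm
    exact ⟨_, hm⟩
  have hsel : ∀ m N, ∃ b : Fin n → K, ∀ i ≤ N, P m i →
      ∀ j ≤ i, ¬ (φ j).Realize (Sum.elim (fun x => a x m) b) := by
    intro m N
    induction N with
    | zero =>
      by_cases h : P m 0
      · obtain ⟨b, hb⟩ := h
        exact ⟨b, fun i hi _ j hj => hb j (hj.trans hi)⟩
      · exact ⟨fun _ => Classical.arbitrary K, fun i hi hPi =>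
          absurd (Nat.le_zero.1 hi ▸ hPi) h⟩
    | succ N ih =>
      by_cases h : P m (N + 1)
      · obtain ⟨b, hb⟩ := h
        exact ⟨b, fun i hi _ j hj => hb j (hj.trans hi)⟩
      · obtain ⟨b, hb⟩ := ih
        refine ⟨b, fun i hi hPi => ?_⟩
        rcases Nat.le_succ_iff.1 hi with hi | rfl
        · exact hb i hi hPi
        · exact absurd hPi h
  choose b hb using fun m => hsel m m
  have hx : (fun i => q fun m => b m i) ∈ ⋃₀ Set.range s :=
    hcov ▸ Set.mem_univ _
  obtain ⟨_, ⟨j, rfl⟩, hj⟩ := hx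
  have h1 := (hLos j fun i m => b m i).1 hj
  have h2 : ∀ᶠ m in (hyperfilter ℕ : Filter ℕ), j ≤ m :=
    Filter.Eventually.filter_mono (Nat.cofinite_eq_atTop ▸ hyperfilter_le_cofinite)
      (eventually_ge_atTop j)
  obtain ⟨m, hm1, hm2, hm3⟩ := (h1.and (h2.and (hP j))).exists
  exact hb m j hm2 hm3 j le_rfl hm1

open FirstOrder.Ring FirstOrder.Field

theorem HPStructure.exists_modelsDelta11HP_and_not_successorAxiom :
    ∃ (M : Type) (N : HPStructure M), N.ModelsDelta11HP ∧ ¬ N.SuccessorAxiom := by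
  let _ := compatibleRingOfRing (AlgebraicClosure ℚ)
  let U := (hyperfilter ℕ : Filter ℕ).Product fun _ : ℕ => AlgebraicClosure ℚ
  have hU : (Theory.ACF 0).Model U := by
    refine Theory.model_iff _ |>.2 fun φ hφ => ?_
    rw [Ultraproduct.sentence_realize]
    exact Eventually.of_forall fun _ => Theory.realize_sentence_of_mem (Theory.ACF 0) hφ
  let _ := fieldOfModelACF 0 U
  have := modelField_of_modelACF 0 U
  let _ := compatibleRingOfModelField U
  have := isAlgClosed_of_model_ACF 0 U
  have := charP_of_model_fieldOfChar 0 U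
  have : CharZero U := CharP.charP_to_charZero U
  have hk : Language.ring.IsDefinablyCompact U :=
    Language.ring.isDefinablyCompact_hyperfilter_product
      (by rw [card_ring]; exact Cardinal.natCast_lt_aleph0 (n := 5) |>.le) _
  exact ⟨U, ofField U, ofField_modelsDelta11HP hk, not_successorAxiom_ofField hk⟩

end Ultrapower

theorem mainTheorem7 :
    (∀ (k : Type u) [Field k] [FirstOrder.Ring.CompatibleRing k] [IsAlgClosed k] [CharZero k],
      FirstOrder.Language.ring.IsSaturated k →
        -- every definable `X ⊆ k` is finite or cofinite, and `#` is given by the stated formula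
        (∀ X : (HPStructure.ofField k).rel 0,
          ((X : Set (Fin 1 → k)).Finite ∨ (X : Set (Fin 1 → k))ᶜ.Finite) ∧
          ((X : Set (Fin 1 → k)).Finite →
            (HPStructure.ofField k).num X = ((X : Set (Fin 1 → k)).ncard : k)) ∧
          ((X : Set (Fin 1 → k))ᶜ.Finite →
            (HPStructure.ofField k).num X = -(((X : Set (Fin 1 → k))ᶜ.ncard : k) + 1))) ∧
        -- the structure is a model of `Δ¹₁-HP₀ + ¬SA`
        (HPStructure.ofField k).ModelsDelta11HP ∧
        ¬ (HPStructure.ofField k).SuccessorAxiom ∧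
        -- the pseudo-numbers are exactly the integers
        (∀ a : k, (HPStructure.ofField k).IsPseudoNumber a ↔ ∃ z : ℤ, a = (z : k)) ∧
        -- `#k = -1` has no successor
        (∃ K : (HPStructure.ofField k).rel 0, (K : Set (Fin 1 → k)) = Set.univ ∧
          (HPStructure.ofField k).num K = -1 ∧
          ¬ ∃ m : k, (HPStructure.ofField k).Precedes ((HPStructure.ofField k).num K) m)) ∧
    -- there is a model of `Δ¹₁-HP₀ + ¬SA`
    (∃ (M : Type) (N : HPStructure M), N.ModelsDelta11HP ∧ ¬ N.SuccessorAxiom) := by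
  refine ⟨fun k _ _ _ _ hs => ?_, HPStructure.exists_modelsDelta11HP_and_not_successorAxiom⟩
  have hk := hs.isDefinablyCompact
  refine ⟨fun X => ⟨Set.Definable.finite_or_finite_compl hk X.2,
      HPStructure.ofField_num_of_finite, HPStructure.ofField_num_of_finite_compl⟩,
    HPStructure.ofField_modelsDelta11HP hk, HPStructure.not_successorAxiom_ofField hk,
    fun a => HPStructure.isPseudoNumber_iff hk, ⟨Set.univ, Set.definable_univ⟩, rfl, ?_, ?_⟩
  · rw [HPStructure.ofField_num_of_finite_compl] <;> simp
  · rw [HPStructure.ofField_num_of_finite_compl (by simp)]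
    simpa using HPStructure.not_precedes_neg_one hk
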